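/- Let $T$ be a (possibly unbounded) self-adjoint operator on a complex Hilbert space $\mathcal{H}$. Let $a<b$ be real numbers in the resolvent set $\rho(T)$, set $\Delta=[a,b]$, and assume that $\Delta\cap\sigma(T)=\{\lambda_1,\dots,\lambda_d\}$ consists of isolated eigenvalues of finite multiplicity, each $\lambda_j$ being repeated according to its multiplicity. Let $E(\Delta)$ be the corresponding spectral projection of $T$. Let $Q$ be a finite-rank orthogonal projection on $\mathcal{H}$ with $$\varepsilon:=\|(I-Q)E(\Delta)\|<1/\sqrt{d},$$ and let $r$ be a real number with $$3\varepsilon<r<\min\Big\{\sqrt{(\lambda_j-a)^2+1},\ \sqrt{(b-\lambda_j)^2+1}\Big\}-1-2\varepsilon\qquad(1\le j\le d).$$ Let $\Gamma_j\subset\mathbb{C}$ be the circle with centre $\lambda_j+i$ and radius $r$, put $X=\bigcup_{j=1}^d\Gamma_j$, and assume that $\Gamma_i\cap\Gamma_j=\varnothing$ whenever $\lambda_i\neq\lambda_j$. Define $$d_X=\operatorname{dist}\big(X,\sigma(T)\setminus\Delta\big),\quad d_\Delta=\operatorname{dist}\big(\{\lambda_1+i,\dots,\lambda_d+i\},X\big),\quad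 c=\min\{d_X-1-2\varepsilon,\ d_\Delta-3\varepsilon\},$$ where $d_X=\infty$ if $\sigma(T)\subset\Delta$. Then for every $j\in\{1,\dots,d\}$: 1. $\Gamma_j\subset\rho(T+iQ)$ and $\operatorname{dist}(\lambda_j+i,\sigma(T+iQ))<r$ (in particular, $\sigma(T+iQ)\neq\varnothing$); 2. $c>0$ and $\|(T+iQ-z)u\|\ge c\,\|u\|$ for all $u\in\operatorname{Dom}(T)$ and all $z\in\Gamma_j$; 3. the spectral subspace associated to $T+iQ$ and the region enclosed by $\Gamma_j$, i.e. the range of the Riesz projection $-\frac{1}{2\pi i}\oint_{\Gamma_j}(T+iQ-z)^{-1}\,dz$, is finite-dimensional, and its dimension equals that of the eigenspace $\ker(T-\lambda_j)$. -/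

import Mathlib

noncomputable section

namespace SpectralPert

variable {H : Type*} [NormedAddCommGroup H] [InnerProductSpace ℂ H]

/-- The bounded operator `R` is the (two-sided) inverse of `A - z : Dom(A) → H`. -/
def IsResolventAt (A : H →ₗ.[ℂ] H) (z : ℂ) (R : H →L[ℂ] H) : Prop :=
  (∀ v : H, ∃ u : A.domain, (u : H) = R v ∧ A u - z • (u : H) = v) ∧
    ∀ u : A.domain, R (A u - z • (u : H)) = u

/-- The resolvent set `ρ(A)` of a (possibly unbounded) operator: the `z` for which
`A - z : Dom(A) → H` is bijective with bounded inverse. -/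
def resolventSet (A : H →ₗ.[ℂ] H) : Set ℂ :=
  {z | ∃ R : H →L[ℂ] H, IsResolventAt A z R}

/-- The spectrum `σ(A) = ℂ \ ρ(A)`. -/
def spectrum (A : H →ₗ.[ℂ] H) : Set ℂ :=
  (resolventSet A)ᶜ

open Classical in
/-- The resolvent `(A - z)⁻¹`, a bounded operator on `H` for `z ∈ ρ(A)` (and `0` otherwise). -/
def resolvent (A : H →ₗ.[ℂ] H) (z : ℂ) : H →L[ℂ] H :=
  if h : z ∈ resolventSet A then h.choose else 0

/-- The eigenspace `ker (A - z)`, as a subspace of `H`. -/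
def eigenspace (A : H →ₗ.[ℂ] H) (z : ℂ) : Submodule ℂ H :=
  (LinearMap.ker (A.toFun - z • A.domain.subtype)).map A.domain.subtype

/-- The discrete spectrum of a self-adjoint operator: the isolated points of the spectrum which are
eigenvalues of finite multiplicity. -/
def discreteSpectrum (A : H →ₗ.[ℂ] H) : Set ℂ :=
  {z | z ∈ spectrum A ∧ (∃ δ > 0, Metric.ball z δ ∩ spectrum A = {z}) ∧
    eigenspace A z ≠ ⊥ ∧ FiniteDimensional ℂ (eigenspace A z)}

/-- The spectral (Riesz) projection associated to `A` and the region enclosed by the circle with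
centre `c` and radius `r`, namely `-(2πi)⁻¹ ∮ (A - z)⁻¹ dz`; the circle should lie in `ρ(A)`. -/
def spectralProj (A : H →ₗ.[ℂ] H) (c : ℂ) (r : ℝ) : H →L[ℂ] H :=
  -(2 * Real.pi * Complex.I : ℂ)⁻¹ • ∮ z in C(c, r), resolvent A z

/-- The spectral subspace associated to `A` and the region enclosed by the circle with centre `c`
and radius `r`: the range of the spectral projection. -/
def spectralSubspace (A : H →ₗ.[ℂ] H) (c : ℂ) (r : ℝ) : Submodule ℂ H :=
  LinearMap.range (spectralProj A c r : H →ₗ[ℂ] H)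

/-- The interval `[a, b]` as a subset of the complex plane. -/
def realInterval (a b : ℝ) : Set ℂ :=
  (fun x : ℝ => (x : ℂ)) '' Set.Icc a b

/-- The spectral projection `E([a, b])` of a self-adjoint operator `T` with `a, b ∈ ρ(T)`.
The spectrum of `T` being real, the part of it in `[a, b]` is the part enclosed by the circle with
diameter `[a, b]`, and this circle lies in `ρ(T)`. -/
def intervalProj (T : H →ₗ.[ℂ] H) (a b : ℝ) : H →L[ℂ] H :=
  spectralProj T (((a + b) / 2 : ℝ) : ℂ) ((b - a) / 2)

/-- The operator `T + iQ` with domain `Dom(T)`. -/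
def perturb (T : H →ₗ.[ℂ] H) (Q : H →L[ℂ] H) : H →ₗ.[ℂ] H :=
  (Complex.I • (Q : H →ₗ[ℂ] H)) +ᵥ T

/-- The distance between two sets, with value `∞` if one of them is empty. -/
def setDist (X Y : Set ℂ) : ENNReal :=
  ⨅ x ∈ X, ⨅ y ∈ Y, edist x y

/-- The circle `Γ_j`, with centre `ev j + i` and radius `r`. -/
def circ {d : ℕ} (ev : Fin d → ℝ) (r : ℝ) (j : Fin d) : Set ℂ :=
  Metric.sphere ((ev j : ℂ) + Complex.I) r

/-- The union `X` of the circles `Γ_j`. -/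
def circUnion {d : ℕ} (ev : Fin d → ℝ) (r : ℝ) : Set ℂ :=
  ⋃ j, circ ev r j

/-- `d_X = dist(X, σ(T) \ [a, b])`, which is `∞` if `σ(T) ⊆ [a, b]`. -/
def distOuter {d : ℕ} (T : H →ₗ.[ℂ] H) (a b : ℝ) (ev : Fin d → ℝ) (r : ℝ) : ENNReal :=
  setDist (circUnion ev r) (spectrum T \ realInterval a b)

/-- `d_Δ = dist({λ₁ + i, …, λ_d + i}, X)`. -/
def distInner {d : ℕ} (ev : Fin d → ℝ) (r : ℝ) : ENNReal :=
  setDist (Set.range fun j => (ev j : ℂ) + Complex.I) (circUnion ev r)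

/-- `c = min {d_X - 1 - 2ε, d_Δ - 3ε}`. The minimum is taken in the extended reals because
`d_X = ∞` is possible; it is finite as soon as there is a circle, since then `d_Δ < ∞`. -/
def lowerConst {d : ℕ} (T : H →ₗ.[ℂ] H) (a b : ℝ) (ev : Fin d → ℝ) (r ε : ℝ) : ℝ :=
  (min ((distOuter T a b ev r : EReal) - 1 - ((2 * ε : ℝ) : EReal))
    ((distInner ev r : EReal) - ((3 * ε : ℝ) : EReal))).toReal

end SpectralPert

end

noncomputable section

namespace SpectralPert

open Filter Topology Metric

variable {H : Type*} [NormedAddCommGroup H] [InnerProductSpace ℂ H]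

/-! ### Resolvents of unbounded operators and bounded perturbations. -/

section Resolvent

/-! Write E for E([a,b]). The operator T + iE is completely understood: the part of the spectrum in
[a,b] is lifted by i, the rest stays real. The circle about λ_j + i therefore isolates exactly the
lifted eigenvalue, and its Riesz projection has range ker(T - λ_j) (`spectralSubspace_add_I_smul`).
It remains to move from T + iE to T + iQ along T + i(E + t(Q - E)), 0 ≤ t ≤ 1, without the spectrum
crossing the circle.

Q - E need not be small, but it splits. Let P be the orthogonal projection onto the range of QE.
Then ‖P - E‖ ≤ ε, while Q - P is a contraction living entirely on ker E (`exists_subprojection`). On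
the range of E the operator T + iE - z is bounded below by d_Δ, and on ker E by d_X
(`le_norm_block`). The term Q - P costs at most 1 on the second block only, and P - E costs at most
ε overall, so the lower bound c holds uniformly in t (`norm_add_smul_ge`). Its positivity is plane
geometry of the circles (`lowerConst_spec`).

A uniform lower bound lets the segment be cut into short steps. Each step keeps the circle in the
resolvent set by a Neumann series and moves the Riesz projection by less than 1 in norm, which
preserves its rank (`spectralProj_homotopy`). Since ker(T - λ_j) ≠ 0, the final projection is
nonzero, so by Cauchy's theorem there is spectrum inside the circle.

No spectral theorem for unbounded operators is needed: R = (T - a)⁻¹ is bounded and self-adjoint,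
and everything concerning T and T + iE is a continuous function of R, through the substitution y = a
+ x⁻¹ between σ(R) \ {0} and σ(T). The point x = 0 plays the role of y = ∞. -/

theorem perturb_eq (T : H →ₗ.[ℂ] H) (Q : H →L[ℂ] H) :
    perturb T Q = ((Complex.I • Q : H →L[ℂ] H) : H →ₗ[ℂ] H) +ᵥ T := rfl

variable {A : H →ₗ.[ℂ] H} {z w : ℂ} {S S' : H →L[ℂ] H}

theorem IsResolventAt.sub_eq (h : IsResolventAt A z S) (h' : IsResolventAt A w S') :
    S - S' = (z - w) • (S * S') := by
  ext v
  obtain ⟨u, hu, huv⟩ := h'.1 v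
  have h1 : v = (A u - z • (u : H)) + (z - w) • (u : H) := by
    rw [← huv]; module
  have h2 : S v = u + (z - w) • S u := by
    conv_lhs => rw [h1]
    rw [map_add, h.2, map_smul]
  simp [h2, hu]

theorem IsResolventAt.unique (h : IsResolventAt A z S) (h' : IsResolventAt A z S') : S = S' := by
  simpa [sub_eq_zero] using h.sub_eq h'

theorem isResolventAt_resolvent (h : z ∈ resolventSet A) :
    IsResolventAt A z (resolvent A z) := by
  rw [resolvent, dif_pos h]; exact h.choose_spec

theorem IsResolventAt.mem (h : IsResolventAt A z S) : z ∈ resolventSet A := ⟨S, h⟩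

theorem IsResolventAt.resolvent_eq (h : IsResolventAt A z S) : resolvent A z = S :=
  (isResolventAt_resolvent h.mem).unique h

theorem resolvent_sub_resolvent (hz : z ∈ resolventSet A) (hw : w ∈ resolventSet A) :
    resolvent A z - resolvent A w = (z - w) • (resolvent A z * resolvent A w) :=
  (isResolventAt_resolvent hz).sub_eq (isResolventAt_resolvent hw)

/-- Perturbation by a bounded operator, together with a change of the spectral parameter. -/
theorem IsResolventAt.vadd (h : IsResolventAt A z S) (B : H →L[ℂ] H) (w : ℂ) {V : H →L[ℂ] H}
    (h₁ : (1 + (B + (z - w) • 1) * S) * V = 1) (h₂ : V * (1 + (B + (z - w) • 1) * S) = 1) :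
    IsResolventAt ((B : H →ₗ[ℂ] H) +ᵥ A) w (S * V) := by
  constructor
  · intro v
    obtain ⟨u, hu, huv⟩ := h.1 (V v)
    refine ⟨u, hu, ?_⟩
    have h3 := congrArg (fun f : H →L[ℂ] H => f v) h₁
    simp only [mul_apply_eq_comp, add_apply,
      one_apply_eq_self, smul_apply, ← hu] at h3
    rw [LinearPMap.vadd_apply]
    rw [← huv] at h3
    rw [← h3]
    simp only [ContinuousLinearMap.coe_coe]
    module
  · intro u
    have h3 := congrArg (fun f : H →L[ℂ] H => f (A u - z • (u : H))) h₂
    have h4 := h.2 u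
    simp only [mul_apply_eq_comp, add_apply,
      one_apply_eq_self, smul_apply, h4] at h3
    rw [LinearPMap.vadd_apply]
    rw [mul_apply_eq_comp]
    conv_rhs => rw [← h4, ← h3]
    congr 2
    simp only [ContinuousLinearMap.coe_coe]
    module

theorem IsResolventAt.vadd_of_isUnit (h : IsResolventAt A z S) (B : H →L[ℂ] H) (w : ℂ)
    (hu : IsUnit (1 + (B + (z - w) • 1) * S)) :
    IsResolventAt ((B : H →ₗ[ℂ] H) +ᵥ A) w
      (S * Ring.inverse (1 + (B + (z - w) • 1) * S)) :=
  h.vadd B w (Ring.mul_inverse_cancel _ hu) (Ring.inverse_mul_cancel _ hu)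

theorem IsResolventAt.change_param (h : IsResolventAt A z S) (w : ℂ)
    (hu : IsUnit (1 + (z - w) • S)) :
    IsResolventAt A w (S * Ring.inverse (1 + (z - w) • S)) := by
  have := h.vadd_of_isUnit 0 w (by simpa using hu)
  simpa using this

theorem IsResolventAt.norm_le (h : IsResolventAt A z S) {c : ℝ} (hc : 0 < c)
    (hb : ∀ u : A.domain, c * ‖(u : H)‖ ≤ ‖A u - z • (u : H)‖) : ‖S‖ ≤ c⁻¹ := by
  refine S.opNorm_le_bound (by positivity) fun v => ?_
  obtain ⟨u, hu, huv⟩ := h.1 v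
  have := hb u
  rw [huv, hu] at this
  rw [inv_mul_eq_div, le_div_iff₀ hc]
  linarith

variable [CompleteSpace H]

/-- The correction factor equals 1 at w = z and units are open, so it stays invertible nearby. The
explicit formula yields both openness of the resolvent set and holomorphy of the resolvent. -/
theorem eventually_resolvent_eq (hz : z ∈ resolventSet A) :
    ∀ᶠ w in 𝓝 z, IsResolventAt A w
      (resolvent A z * Ring.inverse (1 + (z - w) • resolvent A z)) := by
  have hc : ContinuousAt (fun w => 1 + (z - w) • resolvent A z) z := by fun_prop
  have : ∀ᶠ w in 𝓝 z, IsUnit (1 + (z - w) • resolvent A z) := by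
    refine hc.eventually (p := IsUnit) ?_
    refine Units.isOpen.mem_nhds ?_
    simp
  filter_upwards [this] with w hw
  exact (isResolventAt_resolvent hz).change_param w hw

theorem isOpen_resolventSet (A : H →ₗ.[ℂ] H) : IsOpen (resolventSet A) := by
  rw [isOpen_iff_mem_nhds]
  intro z hz
  filter_upwards [eventually_resolvent_eq hz] with w hw using hw.mem

theorem differentiableAt_resolvent (hz : z ∈ resolventSet A) :
    DifferentiableAt ℂ (resolvent A) z := by
  have h1 : resolvent A =ᶠ[𝓝 z]
      fun w => resolvent A z * Ring.inverse (1 + (z - w) • resolvent A z) := by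
    filter_upwards [eventually_resolvent_eq hz] with w hw using hw.resolvent_eq
  refine h1.symm.differentiableAt_iff.mp ?_
  have h2 : DifferentiableAt ℂ (Ring.inverse : (H →L[ℂ] H) → H →L[ℂ] H)
      (1 + (z - z) • resolvent A z) :=
    differentiableAt_inverse (by simp)
  have h3 : DifferentiableAt ℂ (fun w => 1 + (z - w) • resolvent A z) z := by fun_prop
  exact (h2.comp z h3).const_mul _

theorem continuousOn_resolvent (A : H →ₗ.[ℂ] H) : ContinuousOn (resolvent A) (resolventSet A) :=
  fun _ hz => (differentiableAt_resolvent hz).continuousAt.continuousWithinAt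

end Resolvent

/-! ### Circle integrals and Riesz projections. -/

section Riesz

open MeasureTheory

theorem circleIntegral_swap {E : Type*} [NormedAddCommGroup E] [NormedSpace ℂ E]
    {f : ℂ → ℂ → E} {c c' : ℂ} {r r' : ℝ} (hr : 0 ≤ r) (hr' : 0 ≤ r')
    (hf : ContinuousOn (Function.uncurry f) (sphere c r ×ˢ sphere c' r')) :
    (∮ z in C(c, r), ∮ w in C(c', r'), f z w) = ∮ w in C(c', r'), ∮ z in C(c, r), f z w := by
  unfold circleIntegral
  simp_rw [← intervalIntegral.integral_smul]
  have hpi : (0 : ℝ) ≤ 2 * Real.pi := by positivity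
  simp only [intervalIntegral.integral_of_le hpi]
  rw [integral_integral_swap]
  · refine integral_congr_ae (Eventually.of_forall fun x => ?_)
    refine integral_congr_ae (Eventually.of_forall fun y => ?_)
    exact smul_comm _ _ _
  · rw [Measure.prod_restrict]
    have hcont : Continuous (Function.uncurry fun x y : ℝ => deriv (circleMap c r) x •
        deriv (circleMap c' r') y • f (circleMap c r x) (circleMap c' r' y)) := by
      have h1 : Continuous fun p : ℝ × ℝ => f (circleMap c r p.1) (circleMap c' r' p.2) :=
        hf.comp_continuous
          (f := fun p : ℝ × ℝ => (circleMap c r p.1, circleMap c' r' p.2)) (by fun_prop)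
          fun p => ⟨circleMap_mem_sphere _ hr _, circleMap_mem_sphere _ hr' _⟩
      simp only [deriv_circleMap, Function.uncurry_def]
      refine Continuous.smul (by fun_prop) (Continuous.smul (by fun_prop) h1)
    have := hcont.continuousOn.integrableOn_compact (μ := (volume.prod volume))
      ((isCompact_Icc (a := (0 : ℝ)) (b := 2 * Real.pi)).prod
        (isCompact_Icc (a := (0 : ℝ)) (b := 2 * Real.pi)))
    exact this.mono_set (Set.prod_mono Set.Ioc_subset_Icc_self Set.Ioc_subset_Icc_self)

theorem circleIntegral_clm_comp {E F : Type*} [NormedAddCommGroup E] [NormedSpace ℂ E]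
    [CompleteSpace E] [NormedAddCommGroup F] [NormedSpace ℂ F] [CompleteSpace F] (L : E →L[ℂ] F)
    {f : ℂ → E} {c : ℂ} {r : ℝ} (hf : CircleIntegrable f c r) :
    L (∮ z in C(c, r), f z) = ∮ z in C(c, r), L (f z) := by
  unfold circleIntegral
  rw [← L.intervalIntegral_comp_comm hf.out]
  simp only [map_smul]

theorem circleIntegral_inv_sub_of_lt {c w : ℂ} {r : ℝ} (hr : 0 ≤ r) (hw : r < dist w c) :
    (∮ z in C(c, r), (z - w)⁻¹) = 0 := by
  have hne : ∀ z ∈ closedBall c r, z - w ≠ 0 := by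
    intro z hz h0
    rw [sub_eq_zero] at h0
    rw [← h0] at hw
    exact absurd (mem_closedBall.mp hz) (not_le.mpr hw)
  refine Complex.circleIntegral_eq_zero_of_differentiable_on_off_countable hr
    Set.countable_empty ?_ ?_
  · exact ContinuousOn.inv₀ (by fun_prop) hne
  · intro z hz
    exact DifferentiableAt.inv (by fun_prop) (hne z (ball_subset_closedBall hz.1))

variable [CompleteSpace H] {A : H →ₗ.[ℂ] H} {c : ℂ} {r : ℝ}

theorem circleIntegrable_resolvent (hr : 0 ≤ r) (h : sphere c r ⊆ resolventSet A) :
    CircleIntegrable (resolvent A) c r :=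
  ((continuousOn_resolvent A).mono h).circleIntegrable hr

theorem spectralProj_eq_zero (hr : 0 ≤ r) (h : closedBall c r ⊆ resolventSet A) :
    spectralProj A c r = 0 := by
  rw [spectralProj, Complex.circleIntegral_eq_zero_of_differentiable_on_off_countable hr
    Set.countable_empty ((continuousOn_resolvent A).mono h), smul_zero]
  exact fun z hz => differentiableAt_resolvent (h (ball_subset_closedBall hz.1))

/-- The circle is compact in an open set. The second radius serves the product of two contour
integrals in `spectralProj_mul_self`, where the kernel (z - w)⁻¹ must not be singular. -/
theorem exists_larger_circle (hr : 0 < r) (h : sphere c r ⊆ resolventSet A) :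
    ∃ r' > r, closedBall c r' \ ball c r ⊆ resolventSet A := by
  obtain ⟨δ, hδ, hsub⟩ := (isCompact_sphere c r).exists_thickening_subset_open
    (isOpen_resolventSet A) h
  refine ⟨r + δ / 2, by linarith, fun z hz => hsub ?_⟩
  have h1 : dist z c ≤ r + δ / 2 := hz.1
  have h2 : r ≤ dist z c := not_lt.mp hz.2
  have hpos : 0 < dist z c := hr.trans_le h2
  rw [mem_thickening_iff]
  -- The radial projection of z onto the circle, at distance `dist z c - r` from z.
  refine ⟨c + ((r / dist z c : ℝ) : ℂ) • (z - c), ?_, ?_⟩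
  · rw [mem_sphere, dist_eq_norm, add_sub_cancel_left, norm_smul, Complex.norm_real,
      ← dist_eq_norm, Real.norm_of_nonneg (by positivity)]
    field_simp
  · have : z - (c + ((r / dist z c : ℝ) : ℂ) • (z - c)) =
        ((1 - r / dist z c : ℝ) : ℂ) • (z - c) := by
      push_cast; module
    rw [dist_eq_norm, this, norm_smul, Complex.norm_real, ← dist_eq_norm z c,
      Real.norm_of_nonneg (by rw [sub_nonneg, div_le_one hpos]; exact h2)]
    have : (1 - r / dist z c) * dist z c = dist z c - r := by field_simp
    rw [this]; linarith

/-- The Riesz projection is idempotent. -/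
theorem spectralProj_mul_self (hr : 0 < r) (h : sphere c r ⊆ resolventSet A) :
    spectralProj A c r * spectralProj A c r = spectralProj A c r := by
  obtain ⟨r', hrr', hann⟩ := exists_larger_circle hr h
  have hr' : 0 < r' := hr.trans hrr'
  have hs' : sphere c r' ⊆ resolventSet A := by
    refine fun z hz => hann ⟨sphere_subset_closedBall hz, ?_⟩
    rw [mem_ball, mem_sphere.mp hz]; exact not_lt.mpr hrr'.le
  set S := resolvent A with hS
  have heq : (∮ z in C(c, r'), S z) = ∮ z in C(c, r), S z := by
    refine Complex.circleIntegral_eq_of_differentiable_on_annulus_off_countable hr hrr'.le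
      Set.countable_empty ((continuousOn_resolvent A).mono hann) fun z hz => ?_
    exact differentiableAt_resolvent
      (hann ⟨ball_subset_closedBall hz.1.1, fun hb => hz.1.2 (ball_subset_closedBall hb)⟩)
  set J := ∮ z in C(c, r), S z with hJ
  have hint := circleIntegrable_resolvent hr.le h
  have hint' := circleIntegrable_resolvent hr'.le hs'
  have hne : ∀ z ∈ sphere c r, ∀ w ∈ sphere c r', z - w ≠ 0 := by
    intro z hz w hw h0
    rw [sub_eq_zero] at h0
    rw [mem_sphere] at hz hw
    rw [h0] at hz
    linarith
  have hcS : ContinuousOn S (sphere c r) := (continuousOn_resolvent A).mono h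
  have hcS' : ContinuousOn S (sphere c r') := (continuousOn_resolvent A).mono hs'
  have hinvw : ∀ z ∈ sphere c r, ContinuousOn (fun w => (z - w)⁻¹) (sphere c r') :=
    fun z hz => ContinuousOn.inv₀ (by fun_prop) fun w hw => hne z hz w hw
  have key : J * J = -(2 * Real.pi * Complex.I : ℂ) • J := by
    have h1 : J * J = ∮ z in C(c, r), S z * J := by
      conv_lhs => rw [hJ]
      exact circleIntegral_clm_comp ((ContinuousLinearMap.mul ℂ (H →L[ℂ] H)).flip J) hint
    -- The second factor is taken over the larger circle, and the resolvent identity splits the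
    -- product S(z)S(w).
    have h2 : ∀ z ∈ sphere c r, S z * J = (∮ w in C(c, r'), (z - w)⁻¹ • S z) -
        ∮ w in C(c, r'), (z - w)⁻¹ • S w := by
      intro z hz
      rw [← heq, ← circleIntegral.integral_sub]
      · refine (circleIntegral_clm_comp (ContinuousLinearMap.mul ℂ (H →L[ℂ] H) (S z)) hint').trans
          (circleIntegral.integral_congr hr'.le fun w hw => ?_)
        simp only [ContinuousLinearMap.mul_apply']
        rw [← smul_sub, resolvent_sub_resolvent (h hz) (hs' hw), smul_smul,
          inv_mul_cancel₀ (hne z hz w hw), one_smul]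
      · exact ((hinvw z hz).smul continuousOn_const).circleIntegrable hr'.le
      · exact ((hinvw z hz).smul hcS').circleIntegrable hr'.le
    have h3 : ∀ z ∈ sphere c r, (∮ w in C(c, r'), (z - w)⁻¹ • S z) =
        -(2 * Real.pi * Complex.I : ℂ) • S z := by
      intro z hz
      rw [circleIntegral.integral_smul_const]
      have : (∮ w in C(c, r'), (z - w)⁻¹) = -∮ w in C(c, r'), (w - z)⁻¹ := by
        rw [neg_eq_neg_one_mul, ← circleIntegral.integral_const_mul]
        congr 1; ext w
        rw [← neg_sub w z, inv_neg]; ring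
      rw [this, circleIntegral.integral_sub_inv_of_mem_ball
        (by rw [mem_ball, mem_sphere.mp hz]; exact hrr')]
    have hcu : ContinuousOn (Function.uncurry fun z w => (z - w)⁻¹ • S w)
        (sphere c r ×ˢ sphere c r') := by
      have e1 : ContinuousOn (fun p : ℂ × ℂ => (p.1 - p.2)⁻¹) (sphere c r ×ˢ sphere c r') :=
        ContinuousOn.inv₀ (by fun_prop) fun p hp => hne _ hp.1 _ hp.2
      exact e1.smul (hcS'.comp continuousOn_snd fun p hp => hp.2)
    -- After exchanging the integrals, w lies outside the smaller circle, so the integral of (z -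
    -- w)⁻¹ over z vanishes.
    have h4 : (∮ z in C(c, r), ∮ w in C(c, r'), (z - w)⁻¹ • S w) = 0 := by
      rw [circleIntegral_swap hr.le hr'.le hcu]
      rw [circleIntegral.integral_congr hr'.le (g := fun _ => 0)]
      · simp [circleIntegral]
      · intro w hw
        simp only
        rw [circleIntegral.integral_smul_const, circleIntegral_inv_sub_of_lt hr.le
          (by rw [mem_sphere.mp hw]; exact hrr'), zero_smul]
    have h5 : (∮ z in C(c, r), ∮ w in C(c, r'), (z - w)⁻¹ • S z) =
        -(2 * Real.pi * Complex.I : ℂ) • J := by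
      rw [circleIntegral.integral_congr hr.le h3, circleIntegral.integral_smul]
    rw [h1, circleIntegral.integral_congr hr.le h2, circleIntegral.integral_sub, h4, h5, sub_zero]
    · refine ContinuousOn.circleIntegrable hr.le ?_
      exact (hcS.const_smul (-(2 * Real.pi * Complex.I : ℂ))).congr h3
    · refine ContinuousOn.circleIntegrable hr.le ?_
      refine ((hcS.const_smul (-(2 * Real.pi * Complex.I : ℂ))).sub
        (hcS.mul (continuousOn_const (c := J)))).congr fun z hz => ?_
      have := h2 z hz
      rw [h3 z hz] at this
      simp only [Pi.sub_apply, Pi.smul_apply, Pi.mul_apply, this]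
      abel
  have hpi : (2 * Real.pi * Complex.I : ℂ) ≠ 0 := Complex.two_pi_I_ne_zero
  rw [spectralProj, ← hJ, smul_mul_smul_comm, key, smul_smul]
  congr 1
  field_simp

end Riesz

end SpectralPert

end

noncomputable section

namespace SpectralPert

open Filter Topology Metric

variable {H : Type*} [NormedAddCommGroup H] [InnerProductSpace ℂ H]

/-! ### Nearby projections have equal rank. -/

section Rank

/-- P' is injective on the range of P: if Px = x and P'x = 0, then ‖x‖ = ‖(P - P')x‖, which forces x
= 0. -/
theorem finrank_range_le_of_norm_sub_lt_one {P P' : H →L[ℂ] H} (hP : P * P = P)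
    (hlt : ‖P - P'‖ < 1) (hfd : FiniteDimensional ℂ (LinearMap.range (P' : H →ₗ[ℂ] H))) :
    FiniteDimensional ℂ (LinearMap.range (P : H →ₗ[ℂ] H)) ∧
      Module.finrank ℂ (LinearMap.range (P : H →ₗ[ℂ] H)) ≤
        Module.finrank ℂ (LinearMap.range (P' : H →ₗ[ℂ] H)) := by
  set f : LinearMap.range (P : H →ₗ[ℂ] H) →ₗ[ℂ] LinearMap.range (P' : H →ₗ[ℂ] H) :=
    (P' : H →ₗ[ℂ] H).rangeRestrict ∘ₗ (LinearMap.range (P : H →ₗ[ℂ] H)).subtype with hf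
  have hinj : Function.Injective f := by
    rw [← LinearMap.ker_eq_bot, LinearMap.ker_eq_bot']
    rintro ⟨x, y, rfl⟩ hx
    have h1 : P' (P y) = 0 := congrArg Subtype.val hx
    have h2 : P (P y) = P y := congrArg (fun g : H →L[ℂ] H => g y) hP
    have h3 : (P - P') (P y) = P y := by simp [h1, h2]
    have h4 := (P - P').le_opNorm (P y)
    rw [h3] at h4
    have h5 : ‖P y‖ = 0 := by nlinarith [norm_nonneg (P y)]
    exact Subtype.ext (norm_eq_zero.mp h5)
  exact ⟨FiniteDimensional.of_injective f hinj, LinearMap.finrank_le_finrank_of_injective hinj⟩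

end Rank

/-! ### Stability of the Riesz projection under bounded perturbations. -/

section Homotopy

variable [CompleteSpace H] {T : H →ₗ.[ℂ] H} {c : ℂ} {r κ : ℝ}

theorem IsResolventAt.of_small_vadd {A : H →ₗ.[ℂ] H} {z : ℂ} {S : H →L[ℂ] H}
    (h : IsResolventAt A z S) {D : H →L[ℂ] H} (hD : ‖D‖ * ‖S‖ < 1) :
    z ∈ resolventSet ((D : H →ₗ[ℂ] H) +ᵥ A) := by
  refine (h.vadd_of_isUnit D z ?_).mem
  have : IsUnit (1 - -(D * S)) := by
    apply isUnit_one_sub_of_norm_lt_one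
    rw [norm_neg]
    exact (norm_mul_le _ _).trans_lt hD
  simpa using this

theorem IsResolventAt.norm_sub_vadd_le {A : H →ₗ.[ℂ] H} {z : ℂ} {S S' D : H →L[ℂ] H}
    (h : IsResolventAt A z S) (h' : IsResolventAt ((D : H →ₗ[ℂ] H) +ᵥ A) z S') :
    ‖S' - S‖ ≤ ‖S'‖ * ‖D‖ * ‖S‖ := by
  have : S' - S = -(S' * D * S) := by
    ext v
    obtain ⟨u, hu, huv⟩ := h.1 v
    have h1 := h'.2 u
    rw [LinearPMap.vadd_apply, ContinuousLinearMap.coe_coe, add_sub_assoc, huv, map_add] at h1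
    simp only [sub_apply, neg_apply, mul_apply_eq_comp, ← hu]
    rw [eq_sub_of_add_eq' h1]
    abel
  rw [this, norm_neg]
  exact (norm_mul_le _ _).trans (by gcongr; exact norm_mul_le _ _)

/-- Both resolvents are bounded by κ⁻¹ on the circle, so they differ by at most κ⁻¹‖D‖κ⁻¹.
Integration gives projections at distance less than 1, and the rank comparison applies in both
directions. -/
theorem spectralProj_small_vadd {A : H →ₗ.[ℂ] H} {D : H →L[ℂ] H} (hr : 0 < r) (hκ : 0 < κ)
    (hs : sphere c r ⊆ resolventSet A)
    (h₀ : ∀ z ∈ sphere c r, ∀ u : A.domain, κ * ‖(u : H)‖ ≤ ‖A u - z • (u : H)‖)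
    (h₁ : ∀ z ∈ sphere c r, ∀ u : A.domain, κ * ‖(u : H)‖ ≤ ‖D u + A u - z • (u : H)‖)
    (hD : ‖D‖ < κ) (hD' : r * (κ⁻¹ * ‖D‖ * κ⁻¹) < 1)
    (hfd : FiniteDimensional ℂ (spectralSubspace A c r)) :
    sphere c r ⊆ resolventSet ((D : H →ₗ[ℂ] H) +ᵥ A) ∧
    FiniteDimensional ℂ (spectralSubspace ((D : H →ₗ[ℂ] H) +ᵥ A) c r) ∧
    Module.finrank ℂ (spectralSubspace ((D : H →ₗ[ℂ] H) +ᵥ A) c r) =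
      Module.finrank ℂ (spectralSubspace A c r) := by
  have hS : ∀ z ∈ sphere c r, ‖resolvent A z‖ ≤ κ⁻¹ := fun z hz =>
    (isResolventAt_resolvent (hs hz)).norm_le hκ (h₀ z hz)
  have hs' : sphere c r ⊆ resolventSet ((D : H →ₗ[ℂ] H) +ᵥ A) := by
    intro z hz
    refine (isResolventAt_resolvent (hs hz)).of_small_vadd ?_
    calc ‖D‖ * ‖resolvent A z‖ ≤ ‖D‖ * κ⁻¹ := by gcongr; exact hS z hz
      _ < κ * κ⁻¹ := by gcongr
      _ = 1 := mul_inv_cancel₀ hκ.ne'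
  have hS' : ∀ z ∈ sphere c r, ‖resolvent ((D : H →ₗ[ℂ] H) +ᵥ A) z‖ ≤ κ⁻¹ := fun z hz =>
    (isResolventAt_resolvent (hs' hz)).norm_le hκ (h₁ z hz)
  have hlt : ‖spectralProj ((D : H →ₗ[ℂ] H) +ᵥ A) c r - spectralProj A c r‖ < 1 := by
    rw [spectralProj, spectralProj, ← smul_sub, ← circleIntegral.integral_sub
      (circleIntegrable_resolvent hr.le hs') (circleIntegrable_resolvent hr.le hs), neg_smul,
      norm_neg]
    refine (circleIntegral.norm_two_pi_i_inv_smul_integral_le_of_norm_le_const hr.le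
      fun z hz => ?_).trans_lt hD'
    refine ((isResolventAt_resolvent (hs hz)).norm_sub_vadd_le
      (isResolventAt_resolvent (hs' hz))).trans ?_
    gcongr
    · exact hS' z hz
    · exact hS z hz
  obtain ⟨h1, h2⟩ := finrank_range_le_of_norm_sub_lt_one (spectralProj_mul_self hr hs') hlt hfd
  obtain ⟨-, h3⟩ := finrank_range_le_of_norm_sub_lt_one (spectralProj_mul_self hr hs)
    (by rwa [norm_sub_rev]) h1
  exact ⟨hs', h1, h2.antisymm h3⟩

/-- Stability of the rank of the Riesz projection along a segment of bounded perturbations for which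
the operators stay uniformly bounded below on the circle. -/
theorem spectralProj_homotopy (B C : H →L[ℂ] H) (hr : 0 < r) (hκ : 0 < κ)
    (hs : sphere c r ⊆ resolventSet ((B : H →ₗ[ℂ] H) +ᵥ T))
    (hb : ∀ t ∈ Set.Icc (0 : ℝ) 1, ∀ z ∈ sphere c r, ∀ u : T.domain,
      κ * ‖(u : H)‖ ≤ ‖B u + (t : ℂ) • C u + T u - z • (u : H)‖)
    (hfd : FiniteDimensional ℂ (spectralSubspace ((B : H →ₗ[ℂ] H) +ᵥ T) c r)) :
    sphere c r ⊆ resolventSet (((B + C : H →L[ℂ] H) : H →ₗ[ℂ] H) +ᵥ T) ∧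
    FiniteDimensional ℂ (spectralSubspace (((B + C : H →L[ℂ] H) : H →ₗ[ℂ] H) +ᵥ T) c r) ∧
    Module.finrank ℂ (spectralSubspace (((B + C : H →L[ℂ] H) : H →ₗ[ℂ] H) +ᵥ T) c r) =
      Module.finrank ℂ (spectralSubspace ((B : H →ₗ[ℂ] H) +ᵥ T) c r) := by
  -- One n meets both smallness conditions for D = C/n at every step, because κ is uniform along the
  -- segment.
  obtain ⟨n, hn⟩ := exists_nat_gt (max (‖C‖ / κ) (r * (κ⁻¹ * ‖C‖ * κ⁻¹)))
  have hn0 : 0 < (n : ℝ) := lt_of_le_of_lt (le_max_of_le_left (by positivity)) hn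
  have hn1 : ‖C‖ < κ * n := by
    have := (le_max_left _ _).trans_lt hn
    rwa [div_lt_iff₀' hκ] at this
  have hn2 : r * (κ⁻¹ * ‖C‖ * κ⁻¹) < n := (le_max_right _ _).trans_lt hn
  set D : H →L[ℂ] H := ((1 / n : ℝ) : ℂ) • C with hDdef
  have hD : ‖D‖ = ‖C‖ / n := by
    rw [hDdef, norm_smul, Complex.norm_real, Real.norm_of_nonneg (by positivity)]; ring
  set A : ℕ → H →ₗ.[ℂ] H := fun k => ((B + (k : ℂ) • D : H →L[ℂ] H) : H →ₗ[ℂ] H) +ᵥ T with hA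
  have hstep : ∀ k, A (k + 1) = (D : H →ₗ[ℂ] H) +ᵥ A k := by
    intro k
    have : B + ((k + 1 : ℕ) : ℂ) • D = D + (B + (k : ℂ) • D) := by push_cast; module
    simp only [hA]
    rw [this, ContinuousLinearMap.toLinearMap_add, add_vadd]
  have hval : ∀ k, ∀ u : T.domain, A k u = B u + (k : ℂ) • D u + T u := fun k u => rfl
  have hbA : ∀ k ≤ n, ∀ z ∈ sphere c r, ∀ u : T.domain,
      κ * ‖(u : H)‖ ≤ ‖A k u - z • (u : H)‖ := by
    intro k hk z hz u
    have := hb (k / n) ⟨by positivity, by rw [div_le_one hn0]; exact_mod_cast hk⟩ z hz u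
    rw [hval, hDdef, smul_apply, smul_smul]
    convert this using 7
    push_cast; ring
  have main : ∀ k ≤ n, sphere c r ⊆ resolventSet (A k) ∧
      FiniteDimensional ℂ (spectralSubspace (A k) c r) ∧
      Module.finrank ℂ (spectralSubspace (A k) c r) =
        Module.finrank ℂ (spectralSubspace ((B : H →ₗ[ℂ] H) +ᵥ T) c r) := by
    intro k
    induction k with
    | zero =>
      intro _
      have : A 0 = (B : H →ₗ[ℂ] H) +ᵥ T := by simp [hA]
      rw [this]
      exact ⟨hs, hfd, rfl⟩
    | succ k ih =>
      intro hk
      obtain ⟨i1, i2, i3⟩ := ih (by omega)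
      have h1 : ∀ z ∈ sphere c r, ∀ u : T.domain,
          κ * ‖(u : H)‖ ≤ ‖D u + A k u - z • (u : H)‖ := by
        intro z hz u
        have := hbA (k + 1) hk z hz u
        rw [hval] at this ⊢
        convert this using 3
        push_cast; module
      rw [hstep]
      obtain ⟨j1, j2, j3⟩ := spectralProj_small_vadd (D := D) hr hκ i1 (hbA k (by omega)) h1
        (by rw [hD, div_lt_iff₀ hn0]; exact hn1)
        (by
          rw [hD]
          have : r * (κ⁻¹ * (‖C‖ / n) * κ⁻¹) = r * (κ⁻¹ * ‖C‖ * κ⁻¹) / n := by ring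
          rw [this, div_lt_one hn0]; exact hn2) i2
      exact ⟨j1, j2, j3.trans i3⟩
  have hAn : A n = ((B + C : H →L[ℂ] H) : H →ₗ[ℂ] H) +ᵥ T := by
    have : (n : ℂ) • D = C := by
      rw [hDdef, smul_smul]
      have : (n : ℂ) * ((1 / n : ℝ) : ℂ) = 1 := by
        push_cast
        have : (n : ℂ) ≠ 0 := by exact_mod_cast hn0.ne'
        field_simp
      rw [this, one_smul]
    simp only [hA, this]
  rw [← hAn]
  exact main n le_rfl

end Homotopy

end SpectralPert

end

noncomputable section

namespace SpectralPert

open Filter Topology Metric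

variable {H : Type*} [NormedAddCommGroup H] [InnerProductSpace ℂ H]

/-! ### Functional calculus of a resolvent R = (T - a)⁻¹. -/

section FunctionalCalculus

open MeasureTheory

variable {T : H →ₗ.[ℂ] H} {R : H →L[ℂ] H} {a z : ℂ} {e : ℂ → ℂ}

theorem IsResolventAt.isSelfAdjoint [CompleteSpace H] (hT : IsSelfAdjoint T) {a : ℝ}
    (h : IsResolventAt T (a : ℂ) R) : IsSelfAdjoint R := by
  have hsymm : ∀ x y : T.domain, inner ℂ (T x) (y : H) = inner ℂ (x : H) (T y) := by
    have := LinearPMap.adjoint_isFormalAdjoint hT.dense_domain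
    rw [LinearPMap.isSelfAdjoint_def.mp hT] at this
    exact this
  rw [ContinuousLinearMap.isSelfAdjoint_iff_isSymmetric]
  intro v w
  obtain ⟨x, hx, hxv⟩ := h.1 v
  obtain ⟨y, hy, hyw⟩ := h.1 w
  simp only [ContinuousLinearMap.coe_coe, ← hx, ← hy]
  rw [← hxv, ← hyw, inner_sub_left, inner_sub_right, hsymm, inner_smul_left, inner_smul_right]
  simp

/-- If S were the resolvent at a + x⁻¹, then x⁻¹ + x⁻²S would invert x - R, by the resolvent
identity. -/
theorem IsResolventAt.add_inv_mem_spectrum (h : IsResolventAt T a R) {x : ℂ}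
    (hx : x ∈ _root_.spectrum ℂ R) (hx0 : x ≠ 0) : a + x⁻¹ ∈ spectrum T := by
  rintro ⟨S, hS⟩
  have h1 := hS.sub_eq h
  have h2 := h.sub_eq hS
  rw [add_sub_cancel_left] at h1
  rw [sub_add_cancel_left] at h2
  rw [_root_.spectrum.mem_iff] at hx
  refine hx ?_
  rw [Algebra.algebraMap_eq_smul_one]
  have hc : Commute (x • (1 : H →L[ℂ] H) - R) (x⁻¹ • (1 : H →L[ℂ] H) + (x⁻¹ * x⁻¹) • S) := by
    have : Commute R S := by
      have h3 : x⁻¹ • (S * R) = x⁻¹ • (R * S) := by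
        rw [← h1, ← neg_sub, h2, neg_smul, neg_neg]
      have h4 := congrArg (fun f => x • f) h3
      simp only [smul_smul, mul_inv_cancel₀ hx0, one_smul] at h4
      exact h4.symm
    refine Commute.add_right ?_ ?_
    · exact (Commute.one_right _).smul_right _
    · exact (((Commute.one_left S).smul_left x).sub_left this).smul_right _
  have h5 : (x • (1 : H →L[ℂ] H) - R) * (x⁻¹ • (1 : H →L[ℂ] H) + (x⁻¹ * x⁻¹) • S) = 1 := by
    have h6 : R * S = x • (S - R) := by
      rw [← neg_sub R S, h2, neg_smul, neg_neg, smul_smul, mul_inv_cancel₀ hx0, one_smul]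
    simp only [sub_mul, mul_add, smul_mul_assoc, mul_smul_comm, one_mul, mul_one, h6]
    have h7 : x • S - x • (S - R) = x • R := by module
    have h8 : x⁻¹ * x⁻¹ * x = x⁻¹ := by field_simp
    rw [h7, smul_sub, smul_smul, smul_smul, h8, inv_mul_cancel₀ hx0, one_smul, sub_add_cancel]
  exact ⟨⟨_, _, h5, hc.eq ▸ h5⟩, rfl⟩

/-- If `R` is the resolvent of `T` at `a`, this is the function of `R` which is the resolvent at `z`
of the perturbation of `T` by the function `e` of `R`. -/
def resolventFun (e : ℂ → ℂ) (a z x : ℂ) : ℂ := x * (1 + (e x + a - z) * x)⁻¹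

open Classical in
/-- If `R` is the resolvent of `T` at `a`, this is the function of `R` which is the Riesz projection
on the disc of centre `c` and radius `ρ` of the perturbation of `T` by the function `e` of `R`. -/
def discFun (e : ℂ → ℂ) (a c : ℂ) (ρ : ℝ) (x : ℂ) : ℂ :=
  if ‖1 + (e x + a - c) * x‖ < ρ * ‖x‖ then 1 else 0

theorem continuousOn_resolventFun {s : Set ℂ} (he : ContinuousOn e s)
    (hw : ∀ x ∈ s, 1 + (e x + a - z) * x ≠ 0) : ContinuousOn (resolventFun e a z) s := by
  unfold resolventFun
  exact continuousOn_id.mul (ContinuousOn.inv₀ (by fun_prop) hw)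

theorem continuousOn_discFun {s : Set ℂ} {c : ℂ} {ρ : ℝ} (he : ContinuousOn e s)
    (hw : ∀ x ∈ s, ‖1 + (e x + a - c) * x‖ ≠ ρ * ‖x‖) : ContinuousOn (discFun e a c ρ) s := by
  intro x hx
  have h1 : ContinuousWithinAt (fun x => ‖1 + (e x + a - c) * x‖) s x :=
    (show ContinuousOn (fun x => ‖1 + (e x + a - c) * x‖) s by fun_prop) x hx
  have h2 : ContinuousWithinAt (fun x : ℂ => ρ * ‖x‖) s x := by fun_prop
  rcases lt_or_gt_of_ne (hw x hx) with h | h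
  · refine (continuousWithinAt_const (b := (1 : ℂ))).congr_of_eventuallyEq ?_ (if_pos h)
    filter_upwards [h1.eventually_lt h2 h] with y hy using if_pos hy
  · refine (continuousWithinAt_const (b := (0 : ℂ))).congr_of_eventuallyEq ?_
      (if_neg (not_lt.mpr h.le))
    filter_upwards [h2.eventually_lt h1 h] with y hy using if_neg (not_lt.mpr hy.le)

theorem IsResolventAt.mem_eigenspace_iff (h : IsResolventAt T a R) {x : ℂ} (hx : x ≠ 0) {v : H} :
    v ∈ eigenspace T (a + x⁻¹) ↔ R v = x • v := by
  simp only [eigenspace, Submodule.mem_map, LinearMap.mem_ker, LinearMap.sub_apply,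
    LinearMap.smul_apply, Submodule.subtype_apply]
  constructor
  · rintro ⟨u, hu, rfl⟩
    have h1 : T u - a • (u : H) = x⁻¹ • (u : H) := by
      have h2 : T u = (a + x⁻¹) • (u : H) := sub_eq_zero.mp hu
      rw [h2]; module
    have h3 := h.2 u
    rw [h1, map_smul] at h3
    rw [← h3, smul_smul, mul_inv_cancel₀ hx, one_smul, h3]
  · intro hv
    obtain ⟨u, hu, huv⟩ := h.1 v
    refine ⟨x⁻¹ • u, ?_, ?_⟩
    · change T (x⁻¹ • u) - (a + x⁻¹) • ((x⁻¹ • u : T.domain) : H) = 0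
      have h1 : T u = v + a • (x • v) := by rw [← hv, ← hu, ← huv]; abel
      rw [LinearPMap.map_smul, Submodule.coe_smul, h1, hu, hv]
      simp only [smul_add, smul_smul, add_mul, add_smul]
      field_simp
      abel
    · rw [Submodule.coe_smul, hu, hv, smul_smul, inv_mul_cancel₀ hx, one_smul]

variable [CompleteSpace H]

/-- Formally T + e(R) - z = (1 + (e(R) + a - z)R)(T - a), and the first factor is a nonvanishing
continuous function of R. The condition is multiplied through by x so that it makes sense, and holds
automatically, at x = 0. -/
theorem IsResolventAt.cfc_vadd (h : IsResolventAt T a R) (hR : IsSelfAdjoint R)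
    (he : ContinuousOn e (_root_.spectrum ℂ R))
    (hw : ∀ x ∈ _root_.spectrum ℂ R, 1 + (e x + a - z) * x ≠ 0) :
    IsResolventAt (((cfc e R : H →L[ℂ] H) : H →ₗ[ℂ] H) +ᵥ T) z (cfc (resolventFun e a z) R) := by
  have hn : IsStarNormal R := hR.isStarNormal
  have hcw : ContinuousOn (fun x => 1 + (e x + a - z) * x) (_root_.spectrum ℂ R) := by fun_prop
  have hci : ContinuousOn (fun x => (1 + (e x + a - z) * x)⁻¹) (_root_.spectrum ℂ R) :=
    hcw.inv₀ hw
  have h1 : 1 + (cfc e R + (a - z) • 1) * R = cfc (fun x => 1 + (e x + a - z) * x) R := by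
    have h3 : cfc (fun x => e x + (a - z)) R = cfc e R + (a - z) • 1 := by
      rw [cfc_add R e (fun _ => a - z) he continuousOn_const, cfc_const (a - z) R,
        Algebra.algebraMap_eq_smul_one]
    have h4 : cfc (fun x => (e x + (a - z)) * x) R = cfc (fun x => e x + (a - z)) R * R := by
      rw [cfc_mul (fun x => e x + (a - z)) (fun x => x) R (he.add continuousOn_const)
        continuousOn_id, cfc_id' ℂ R]
    rw [← h3, ← h4, ← cfc_const_one ℂ R, ← cfc_add R (fun _ => 1)
      (fun x => (e x + (a - z)) * x) continuousOn_const
      ((he.add continuousOn_const).mul continuousOn_id)]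
    simp only [add_sub_assoc]
  have h2 : cfc (resolventFun e a z) R = R * cfc (fun x => (1 + (e x + a - z) * x)⁻¹) R := by
    unfold resolventFun
    rw [cfc_mul (fun x => x) (fun x => (1 + (e x + a - z) * x)⁻¹) R continuousOn_id hci, cfc_id' ℂ R]
  rw [h2]
  refine h.vadd _ z ?_ ?_
  · rw [h1, ← cfc_mul _ _ R hcw hci, ← cfc_const_one ℂ R]
    exact cfc_congr fun x hx => mul_inv_cancel₀ (hw x hx)
  · rw [h1, ← cfc_mul _ _ R hci hcw, ← cfc_const_one ℂ R]
    exact cfc_congr fun x hx => inv_mul_cancel₀ (hw x hx)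

/-- For x ≠ 0 the integrand is -(z - y)⁻¹ with y = a + x⁻¹ + e(x), so the integral is a winding
number. For x = 0 both sides vanish: the point at infinity is outside every disc. -/
theorem circleIntegral_resolventFun {c x : ℂ} {ρ : ℝ} (hρ : 0 < ρ)
    (hw : ‖1 + (e x + a - c) * x‖ ≠ ρ * ‖x‖) :
    (-(2 * Real.pi * Complex.I : ℂ)⁻¹ * ∮ z in C(c, ρ), resolventFun e a z x) =
      discFun e a c ρ x := by
  rcases eq_or_ne x 0 with rfl | hx
  · simp [resolventFun, discFun, circleIntegral]
  set y := x⁻¹ + e x + a with hy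
  have h1 : ∀ z, resolventFun e a z x = -1 * (z - y)⁻¹ := by
    intro z
    have : 1 + (e x + a - z) * x = (y - z) * x := by rw [hy]; field_simp; ring
    rw [resolventFun, this, mul_inv, ← neg_sub z y, inv_neg]
    field_simp
  have h2 : ‖1 + (e x + a - c) * x‖ = ‖y - c‖ * ‖x‖ := by
    rw [← norm_mul]; congr 1; rw [hy]; field_simp; ring
  have hx' : 0 < ‖x‖ := norm_pos_iff.mpr hx
  have hpi : (2 * Real.pi * Complex.I : ℂ) ≠ 0 := Complex.two_pi_I_ne_zero
  simp only [h1, circleIntegral.integral_const_mul]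
  unfold discFun
  rw [h2] at hw ⊢
  rcases lt_or_gt_of_ne hw with h | h
  · rw [if_pos h, circleIntegral.integral_sub_inv_of_mem_ball]
    · field_simp
    · rw [mem_ball, dist_eq_norm]; exact lt_of_mul_lt_mul_right h hx'.le
  · rw [if_neg (not_lt.mpr h.le), circleIntegral_inv_sub_of_lt hρ.le]
    · simp
    · rw [dist_eq_norm]; exact lt_of_mul_lt_mul_right h hx'.le

theorem one_add_mul_ne_zero_of_mem_sphere {b c z x : ℂ} {ρ : ℝ}
    (hw : ‖1 + (b - c) * x‖ ≠ ρ * ‖x‖) (hz : z ∈ sphere c ρ) : 1 + (b - z) * x ≠ 0 := by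
  intro h0
  apply hw
  have : 1 + (b - c) * x = (z - c) * x := by linear_combination h0
  rw [this, norm_mul, ← dist_eq_norm, mem_sphere.mp hz]

/-- The Riesz projection of the perturbation of `T` by a function of one of its resolvents. -/
theorem IsResolventAt.spectralProj_cfc_vadd (h : IsResolventAt T a R) (hR : IsSelfAdjoint R)
    (he : ContinuousOn e (_root_.spectrum ℂ R)) {c : ℂ} {ρ : ℝ} (hρ : 0 < ρ)
    (hw : ∀ x ∈ _root_.spectrum ℂ R, ‖1 + (e x + a - c) * x‖ ≠ ρ * ‖x‖) :
    spectralProj (((cfc e R : H →L[ℂ] H) : H →ₗ[ℂ] H) +ᵥ T) c ρ = cfc (discFun e a c ρ) R := by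
  have hn : IsStarNormal R := hR.isStarNormal
  have hw' : ∀ z ∈ sphere c ρ, ∀ x ∈ _root_.spectrum ℂ R, 1 + (e x + a - z) * x ≠ 0 :=
    fun z hz x hx => one_add_mul_ne_zero_of_mem_sphere (hw x hx) hz
  have hpi : (0 : ℝ) ≤ 2 * Real.pi := by positivity
  set k : ℂ := -(2 * Real.pi * Complex.I : ℂ)⁻¹ with hk
  set F : ℝ → ℂ → ℂ := fun θ x =>
    k * (deriv (circleMap c ρ) θ * resolventFun e a (circleMap c ρ θ) x) with hF
  have hFc : ContinuousOn (Function.uncurry F) (Set.univ ×ˢ _root_.spectrum ℂ R) := by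
    obtain ⟨g, hg⟩ : ∃ g : ℝ × ℂ → ℂ, ∀ p, g p = e p.2 := ⟨_, fun _ => rfl⟩
    have e1 : ContinuousOn g (Set.univ ×ˢ _root_.spectrum ℂ R) :=
      (he.comp continuousOn_snd fun p hp => hp.2).congr fun p _ => hg p
    have e2 : ContinuousOn (fun p : ℝ × ℂ => (1 + (g p + a - circleMap c ρ p.1) * p.2)⁻¹)
        (Set.univ ×ˢ _root_.spectrum ℂ R) := by
      refine ContinuousOn.inv₀ (by fun_prop) fun p hp => ?_
      rw [hg]
      exact hw' _ (circleMap_mem_sphere _ hρ.le _) _ hp.2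
    simp only [hF, deriv_circleMap, Function.uncurry_def, resolventFun, ← hg]
    fun_prop
  -- Compactness gives the uniform bound that allows the contour integral to be taken inside the
  -- functional calculus.
  have hK : IsCompact (Set.Icc (0 : ℝ) (2 * Real.pi) ×ˢ _root_.spectrum ℂ R) :=
    isCompact_Icc.prod (spectrum.isCompact R)
  obtain ⟨M, hM⟩ := hK.exists_bound_of_continuousOn
    (hFc.mono (Set.prod_mono (Set.subset_univ _) le_rfl))
  have h1 : spectralProj (((cfc e R : H →L[ℂ] H) : H →ₗ[ℂ] H) +ᵥ T) c ρ =
      ∫ θ in Set.Ioc (0 : ℝ) (2 * Real.pi), cfc (F θ) R := by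
    rw [spectralProj, circleIntegral, intervalIntegral.integral_of_le hpi, ← integral_smul]
    refine integral_congr_ae (Eventually.of_forall fun θ => ?_)
    have hz : circleMap c ρ θ ∈ sphere c ρ := circleMap_mem_sphere _ hρ.le _
    have hc := continuousOn_resolventFun he (hw' _ hz)
    simp only [hF]
    rw [(h.cfc_vadd hR he (hw' _ hz)).resolvent_eq, cfc_const_mul k (fun x => deriv (circleMap c ρ) θ *
      resolventFun e a (circleMap c ρ θ) x) R (continuousOn_const.mul hc), cfc_const_mul _ _ R hc]
  rw [h1, ← cfc_setIntegral measurableSet_Ioc F (fun _ => M) R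
    (hFc.mono (Set.prod_mono (Set.subset_univ _) le_rfl))]
  · refine cfc_congr fun x hx => ?_
    rw [← circleIntegral_resolventFun hρ (hw x hx), circleIntegral,
      intervalIntegral.integral_of_le hpi, ← integral_const_mul]
    simp only [hF, smul_eq_mul, hk]
  · refine ae_restrict_of_forall_mem measurableSet_Ioc fun θ hθ x hx => ?_
    exact hM (θ, x) ⟨Set.Ioc_subset_Icc_self hθ, hx⟩
  · exact hasFiniteIntegral_const M

theorem isStarProjection_cfc_discFun (hR : IsSelfAdjoint R) {c : ℂ} {ρ : ℝ}
    (hc : ContinuousOn (discFun e a c ρ) (_root_.spectrum ℂ R)) :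
    IsStarProjection (cfc (discFun e a c ρ) R) := by
  have hn : IsStarNormal R := hR.isStarNormal
  constructor
  · rw [IsIdempotentElem, ← cfc_mul _ _ R hc hc]
    congr 1; ext x; simp [discFun]
  · rw [isSelfAdjoint_iff, ← cfc_star]
    congr 1; ext x; simp only [discFun]; split_ifs <;> simp

/-- The range of a spectral projection concentrated at one point is an eigenspace. -/
theorem range_cfc_eq_eigenspace (h : IsResolventAt T a R) (hR : IsSelfAdjoint R) {f : ℂ → ℂ}
    (hf : ContinuousOn f (_root_.spectrum ℂ R)) {x₀ : ℂ} (hx₀ : x₀ ≠ 0)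
    (hf₁ : ∀ x ∈ _root_.spectrum ℂ R, x = x₀ → f x = 1)
    (hf₀ : ∀ x ∈ _root_.spectrum ℂ R, x ≠ x₀ → f x = 0) :
    LinearMap.range ((cfc f R : H →L[ℂ] H) : H →ₗ[ℂ] H) = eigenspace T (a + x₀⁻¹) := by
  have hn : IsStarNormal R := hR.isStarNormal
  ext v
  rw [h.mem_eigenspace_iff hx₀]
  constructor
  · rintro ⟨y, rfl⟩
    have h1 : R * cfc f R = x₀ • cfc f R := by
      have h2 : cfc (fun x => x * f x) R = R * cfc f R := by
        rw [cfc_mul (fun x => x) f R continuousOn_id hf, cfc_id' ℂ R]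
      rw [← h2, ← cfc_const_mul _ _ R hf]
      refine cfc_congr fun x hx => ?_
      by_cases hxx : x = x₀
      · simp [hxx]
      · simp [hf₀ x hx hxx]
    exact congrArg (fun g : H →L[ℂ] H => g y) h1
  · intro hv
    -- A continuous version of (1 - f(x))/(x - x₀): adding f makes the denominator 1 at x₀ and
    -- changes nothing elsewhere on the spectrum. Hence 1 - f(R) factors through R - x₀.
    have hg : ContinuousOn (fun x => (1 - f x) * (x - x₀ + f x)⁻¹) (_root_.spectrum ℂ R) := by
      refine (continuousOn_const.sub hf).mul (ContinuousOn.inv₀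
        ((continuousOn_id.sub continuousOn_const).add hf) fun x hx => ?_)
      by_cases hxx : x = x₀
      · rw [hf₁ x hx hxx, hxx]; simp
      · simpa [hf₀ x hx hxx, sub_eq_zero] using hxx
    have h1 : 1 - cfc f R = cfc (fun x => (1 - f x) * (x - x₀ + f x)⁻¹) R * (R - x₀ • 1) := by
      have h2 : R - x₀ • 1 = cfc (fun x => x - x₀) R := by
        rw [cfc_sub (fun x => x) (fun _ => x₀) R continuousOn_id continuousOn_const, cfc_id' ℂ R,
          cfc_const x₀ R, Algebra.algebraMap_eq_smul_one]
      rw [h2, ← cfc_mul _ (fun x => x - x₀) R hg (continuousOn_id.sub continuousOn_const),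
        ← cfc_const_one ℂ R, ← cfc_sub (fun _ => 1) f R continuousOn_const hf]
      refine cfc_congr fun x hx => ?_
      by_cases hxx : x = x₀
      · simp [hf₁ x hx hxx]
      · simp [hf₀ x hx hxx, inv_mul_cancel₀ (sub_ne_zero.mpr hxx)]
    have h3 := congrArg (fun g : H →L[ℂ] H => g v) h1
    simp only [sub_apply, mul_apply_eq_comp, one_apply_eq_self, smul_apply, hv, sub_self,
      map_zero] at h3
    exact ⟨v, (sub_eq_zero.mp h3).symm⟩

end FunctionalCalculus

end SpectralPert

end

noncomputable section

namespace SpectralPert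

variable {H : Type*} [NormedAddCommGroup H] [InnerProductSpace ℂ H] [CompleteSpace H]

/-! ### Geometry of two orthogonal projections. -/

section Projections

open Submodule

variable {E Q : H →L[ℂ] H}

theorem inner_apply_left_of_isStarProjection (hE : IsStarProjection E) (x y : H) :
    inner ℂ (E x) y = inner ℂ x (E y) := by
  rw [← ContinuousLinearMap.adjoint_inner_right, ← ContinuousLinearMap.star_eq_adjoint,
    hE.isSelfAdjoint.star_eq]

theorem apply_apply_of_isStarProjection (hE : IsStarProjection E) (x : H) : E (E x) = E x :=
  congrArg (fun f : H →L[ℂ] H => f x) hE.isIdempotentElem.eq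

theorem norm_sq_of_isStarProjection (hE : IsStarProjection E) (x : H) :
    ‖x‖ ^ 2 = ‖E x‖ ^ 2 + ‖x - E x‖ ^ 2 := by
  have h0 : inner ℂ (E x) (x - E x) = 0 := by
    rw [inner_apply_left_of_isStarProjection hE, map_sub, apply_apply_of_isStarProjection hE,
      sub_self, inner_zero_right]
  have := norm_add_sq_eq_norm_sq_add_norm_sq_of_inner_eq_zero (E x) (x - E x) h0
  rw [add_sub_cancel] at this
  nlinarith

theorem norm_apply_le_of_isStarProjection (hE : IsStarProjection E) (x : H) : ‖E x‖ ≤ ‖x‖ := by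
  have := norm_sq_of_isStarProjection hE x
  exact (abs_le_of_sq_le_sq' (by nlinarith [sq_nonneg ‖x - E x‖]) (norm_nonneg _)).2

/-- If an orthogonal projection `Q` is applied to a vector `u`, the angle between `Q u` and `u` is
controlled by `u - Q u`. -/
theorem norm_sub_apply_le_of_isStarProjection (hE : IsStarProjection E) (hQ : IsStarProjection Q)
    {u : H} (hu : E u = u) {ε : ℝ} (hε : 0 ≤ ε) (h : ‖u - Q u‖ ≤ ε * ‖u‖) :
    ‖Q u - E (Q u)‖ ≤ ε * ‖Q u‖ := by
  rcases eq_or_ne u 0 with rfl | hu0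
  · simp
  have hup : 0 < ‖u‖ := norm_pos_iff.mpr hu0
  have h1 := norm_sq_of_isStarProjection hQ u
  -- Since ⟨Qu, u⟩ = ‖Qu‖², the vector s • u is the orthogonal projection of Qu onto the line of u.
  set s : ℝ := ‖Q u‖ ^ 2 / ‖u‖ ^ 2 with hs
  have hsu : s * ‖u‖ ^ 2 = ‖Q u‖ ^ 2 := by rw [hs]; field_simp
  have h2 : inner ℂ (Q u) u = ((‖Q u‖ ^ 2 : ℝ) : ℂ) := by
    rw [← apply_apply_of_isStarProjection hQ u, inner_apply_left_of_isStarProjection hQ,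
      apply_apply_of_isStarProjection hQ, inner_self_eq_norm_sq_to_K]
    simp
  -- the distance from `Q u` to the range of `E` is at most the distance to `s • u`
  have h3 : ‖Q u - E (Q u)‖ ^ 2 ≤ ‖Q u - (s : ℂ) • u‖ ^ 2 := by
    have := norm_sq_of_isStarProjection hE (Q u - (s : ℂ) • u)
    rw [this, map_sub, map_smul, hu]
    have h4 : Q u - (s : ℂ) • u - (E (Q u) - (s : ℂ) • u) = Q u - E (Q u) := by abel
    rw [h4]
    nlinarith [sq_nonneg ‖E (Q u) - (s : ℂ) • u‖]
  have h5 : ‖Q u - (s : ℂ) • u‖ ^ 2 = ‖Q u‖ ^ 2 - s * ‖Q u‖ ^ 2 := by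
    rw [@norm_sub_sq ℂ, inner_smul_right, h2, norm_smul, Complex.norm_real, ← Complex.ofReal_mul,
      mul_pow, Real.norm_eq_abs, sq_abs]
    simp only [RCLike.re_to_complex, Complex.ofReal_re]
    linear_combination s * hsu
  have h6 : ‖Q u‖ ^ 2 - s * ‖Q u‖ ^ 2 = s * ‖u - Q u‖ ^ 2 := by
    linear_combination -hsu + s * h1
  have hs0 : 0 ≤ s := by positivity
  refine abs_le_of_sq_le_sq' ?_ (by positivity) |>.2
  calc ‖Q u - E (Q u)‖ ^ 2 ≤ s * ‖u - Q u‖ ^ 2 := by rw [← h6, ← h5]; exact h3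
    _ ≤ s * (ε * ‖u‖) ^ 2 := by gcongr
    _ = (ε * ‖Q u‖) ^ 2 := by rw [mul_pow, mul_pow, ← hsu]; ring

/-- A finite rank projection `Q` splits into a part close to `E` and a part orthogonal to `E`. -/
theorem exists_subprojection (hE : IsStarProjection E) (hQ : IsStarProjection Q)
    (hfin : FiniteDimensional ℂ (LinearMap.range (Q : H →ₗ[ℂ] H))) :
    ∃ P : H →L[ℂ] H, (∀ x, (Q - P) (E x) = 0) ∧ (∀ x, E ((Q - P) x) = 0) ∧
      (∀ x, ‖(Q - P) x‖ ≤ ‖x‖) ∧ ‖P - E‖ ≤ ‖(1 - Q) * E‖ := by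
  set ε := ‖(1 - Q) * E‖ with hε
  have hε0 : 0 ≤ ε := norm_nonneg _
  set U : Submodule ℂ H := LinearMap.range ((Q * E : H →L[ℂ] H) : H →ₗ[ℂ] H) with hU
  have hUQ : U ≤ LinearMap.range (Q : H →ₗ[ℂ] H) := by
    rintro _ ⟨x, rfl⟩; exact ⟨E x, rfl⟩
  have hUfin : FiniteDimensional ℂ U := Submodule.finiteDimensional_of_le hUQ
  set P : H →L[ℂ] H := U.starProjection with hP
  have hPs : IsStarProjection P := isStarProjection_starProjection
  have hQP : ∀ x, Q (P x) = P x := by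
    intro x
    obtain ⟨y, hy⟩ := hUQ (U.starProjection_apply_mem x)
    rw [hP, ← hy]
    exact apply_apply_of_isStarProjection hQ y
  have hPQ : ∀ x, P (Q x) = P x := by
    intro x
    refine ext_inner_left ℂ fun y => ?_
    rw [← inner_apply_left_of_isStarProjection hPs, ← inner_apply_left_of_isStarProjection hQ, hQP,
      inner_apply_left_of_isStarProjection hPs]
  have hPE : ∀ x, P (E x) = Q (E x) := by
    intro x
    rw [← hPQ]
    exact Submodule.starProjection_eq_self_iff.mpr ⟨x, rfl⟩
  have h1 : ∀ x, (Q - P) (E x) = 0 := fun x => by rw [sub_apply, hPE, sub_self]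
  have hbd : ∀ x, ‖E x - Q (E x)‖ ≤ ε * ‖E x‖ := by
    intro x
    have := ((1 - Q) * E).le_opNorm (E x)
    simpa [apply_apply_of_isStarProjection hE] using this
  have hEP : ∀ x, ‖P x - E (P x)‖ ≤ ε * ‖P x‖ := by
    intro x
    obtain ⟨y, hy⟩ := U.starProjection_apply_mem x
    have hy' : P x = Q (E y) := hy.symm
    rw [hy']
    exact norm_sub_apply_le_of_isStarProjection hE hQ (apply_apply_of_isStarProjection hE y) hε0
      (hbd y)
  -- the adjoint estimate
  have hPE' : ∀ x, ‖P (x - E x)‖ ≤ ε * ‖x - E x‖ := by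
    intro x
    set y := x - E x with hy
    have hEy : E y = 0 := by rw [hy, map_sub, apply_apply_of_isStarProjection hE, sub_self]
    have h2 : inner ℂ (P y) (P y) = inner ℂ y (P y - E (P y)) := by
      rw [inner_sub_right, ← inner_apply_left_of_isStarProjection hE, hEy, inner_zero_left,
        sub_zero, inner_apply_left_of_isStarProjection hPs, apply_apply_of_isStarProjection hPs]
    have h3 : ‖P y‖ ^ 2 ≤ ‖y‖ * (ε * ‖P y‖) := by
      have h4 : ‖inner ℂ (P y) (P y)‖ = ‖P y‖ ^ 2 := by
        rw [inner_self_eq_norm_sq_to_K]; simp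
      rw [← h4, h2]
      exact (norm_inner_le_norm _ _).trans (by gcongr; exact hEP y)
    rcases (norm_nonneg (P y)).eq_or_lt with h0 | h0
    · rw [← h0]; positivity
    · nlinarith
  refine ⟨P, h1, ?_, ?_, ?_⟩
  -- E(Q - P) is the adjoint of (Q - P)E, which vanishes.
  · intro x
    refine ext_inner_left ℂ fun y => ?_
    rw [← inner_apply_left_of_isStarProjection hE, sub_apply, inner_sub_right,
      ← inner_apply_left_of_isStarProjection hQ, ← inner_apply_left_of_isStarProjection hPs, hPE,
      sub_self, inner_zero_right]
  · intro x
    have : (Q - P) x = Q x - P (Q x) := by rw [hPQ, sub_apply]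
    rw [this]
    refine le_trans ?_ (norm_apply_le_of_isStarProjection hQ x)
    have h2 := norm_sq_of_isStarProjection hPs (Q x)
    nlinarith [norm_nonneg (Q x), norm_nonneg (Q x - P (Q x)), sq_nonneg ‖P (Q x)‖]
  · refine ContinuousLinearMap.opNorm_le_bound _ hε0 fun x => ?_
    refine abs_le_of_sq_le_sq' ?_ (by positivity) |>.2
    -- The components of (P - E)x along P and its complement are P(1 - E)x and -(1 - Q)Ex, of norm
    -- at most ε‖(1 - E)x‖ and ε‖Ex‖. Pythagoras, for P and then for E, combines them without loss.
    have h2 : P ((P - E) x) = P (x - E x) := by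
      rw [sub_apply, map_sub, map_sub, apply_apply_of_isStarProjection hPs]
    have h3 : (P - E) x - P ((P - E) x) = -(E x - Q (E x)) := by
      rw [h2, sub_apply, map_sub, hPE]; abel
    rw [norm_sq_of_isStarProjection hPs ((P - E) x), h3, h2, norm_neg, mul_pow,
      norm_sq_of_isStarProjection hE x]
    have h4 := pow_le_pow_left₀ (norm_nonneg _) (hPE' x) 2
    have h5 := pow_le_pow_left₀ (norm_nonneg _) (hbd x) 2
    nlinarith

/-- A lower bound for a perturbation by `Q - E = (Q - P) + (P - E)`. -/
theorem norm_add_smul_ge (hE : IsStarProjection E) {P : H →L[ℂ] H}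
    (h₁ : ∀ x, (Q - P) (E x) = 0) (h₂ : ∀ x, E ((Q - P) x) = 0) (h₃ : ∀ x, ‖(Q - P) x‖ ≤ ‖x‖)
    {ε κ d₁ d₂ : ℝ} (h₄ : ‖P - E‖ ≤ ε) (hκ : 0 ≤ κ) (hd₁ : κ + ε ≤ d₁) (hd₂ : κ + ε + 1 ≤ d₂)
    {u v : H} (hu₁ : d₁ * ‖E u‖ ≤ ‖E v‖) (hu₂ : d₂ * ‖u - E u‖ ≤ ‖v - E v‖)
    {s : ℂ} (hs : ‖s‖ ≤ 1) : κ * ‖u‖ ≤ ‖v + s • (Q - E) u‖ := by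
  have hε0 : 0 ≤ ε := (norm_nonneg _).trans h₄
  set y := v + s • (Q - P) u with hy
  have hEy : E y = E v := by rw [hy, map_add, map_smul, h₂, smul_zero, add_zero]
  have hQu : (Q - P) u = (Q - P) (u - E u) := by rw [map_sub, h₁, sub_zero]
  -- Q - P maps ker E to itself and kills the range of E, so its cost of at most 1 falls on this
  -- block alone.
  have hyb : (κ + ε) * ‖u - E u‖ ≤ ‖y - E y‖ := by
    have h5 : ‖s • (Q - P) u‖ ≤ ‖u - E u‖ := by
      rw [norm_smul, hQu]
      calc _ ≤ 1 * ‖u - E u‖ := by gcongr; exact h₃ _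
        _ = _ := one_mul _
    have h6 : ‖v - E v‖ ≤ ‖y - E y‖ + ‖s • (Q - P) u‖ := by
      have : v - E v = (y - E y) - s • (Q - P) u := by rw [hEy, hy]; abel
      rw [this]; exact norm_sub_le _ _
    nlinarith [norm_nonneg (u - E u)]
  have hyE : (κ + ε) * ‖E u‖ ≤ ‖E y‖ := by
    rw [hEy]; exact (mul_le_mul_of_nonneg_right hd₁ (norm_nonneg _)).trans hu₁
  have hyu : (κ + ε) * ‖u‖ ≤ ‖y‖ := by
    refine abs_le_of_sq_le_sq' ?_ (norm_nonneg _) |>.2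
    rw [mul_pow, norm_sq_of_isStarProjection hE u, norm_sq_of_isStarProjection hE y]
    have h7 := pow_le_pow_left₀ (by positivity) hyb 2
    have h8 := pow_le_pow_left₀ (by positivity) hyE 2
    nlinarith
  have h9 : y = (v + s • (Q - E) u) - s • (P - E) u := by
    rw [hy]; simp only [sub_apply]; module
  have h10 : ‖s • (P - E) u‖ ≤ ε * ‖u‖ := by
    rw [norm_smul]
    calc _ ≤ 1 * (ε * ‖u‖) := by
          gcongr
          exact ((P - E).le_opNorm u).trans (by gcongr)
      _ = _ := one_mul _
  have h11 : ‖y‖ ≤ ‖v + s • (Q - E) u‖ + ‖s • (P - E) u‖ := by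
    conv_lhs => rw [h9]
    exact norm_sub_le _ _
  linarith

end Projections

end SpectralPert

end

noncomputable section

namespace SpectralPert

open Filter Topology Metric

/-! ### Distances between sets and circles in the plane. -/

section Distances

theorem setDist_le {X Y : Set ℂ} {x y : ℂ} (hx : x ∈ X) (hy : y ∈ Y) :
    setDist X Y ≠ ⊤ ∧ (setDist X Y).toReal ≤ dist x y := by
  have h : setDist X Y ≤ edist x y := (iInf₂_le x hx).trans (iInf₂_le y hy)
  refine ⟨ne_top_of_le_ne_top (edist_ne_top x y) h, ?_⟩
  rw [dist_edist]
  exact ENNReal.toReal_mono (edist_ne_top x y) h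

theorem le_toReal_setDist {X Y : Set ℂ} {s : ℝ} (h : ∀ x ∈ X, ∀ y ∈ Y, s ≤ dist x y)
    (hne : setDist X Y ≠ ⊤) : s ≤ (setDist X Y).toReal := by
  refine (ENNReal.ofReal_le_iff_le_toReal hne).mp ?_
  refine le_iInf₂ fun x hx => le_iInf₂ fun y hy => ?_
  rw [edist_dist]
  exact ENNReal.ofReal_le_ofReal (h x hx y hy)

theorem toReal_min_sub {p q : ENNReal} (hq : q ≠ ⊤) (ε : ℝ) :
    (p = ⊤ ∧ (min ((p : EReal) - 1 - ((2 * ε : ℝ) : EReal))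
      ((q : EReal) - ((3 * ε : ℝ) : EReal))).toReal = q.toReal - 3 * ε) ∨
    (p ≠ ⊤ ∧ (min ((p : EReal) - 1 - ((2 * ε : ℝ) : EReal))
      ((q : EReal) - ((3 * ε : ℝ) : EReal))).toReal =
        min (p.toReal - 1 - 2 * ε) (q.toReal - 3 * ε)) := by
  lift q to NNReal using hq
  have hq' : ((q : ENNReal) : EReal) - ((3 * ε : ℝ) : EReal) = ((q - 3 * ε : ℝ) : EReal) := by
    rw [EReal.coe_sub]; rfl
  rw [hq']
  by_cases hp : p = ⊤
  · left
    refine ⟨hp, ?_⟩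
    have : ((⊤ : ENNReal) : EReal) - 1 - ((2 * ε : ℝ) : EReal) = ⊤ := by
      rw [EReal.coe_ennreal_top, ← EReal.coe_one, EReal.top_sub_coe, EReal.top_sub_coe]
    rw [hp, this, min_eq_right le_top, EReal.toReal_coe]
    rfl
  · right
    refine ⟨hp, ?_⟩
    lift p to NNReal using hp
    have hp' : ((p : ENNReal) : EReal) - 1 - ((2 * ε : ℝ) : EReal) =
        ((p - 1 - 2 * ε : ℝ) : EReal) := by
      rw [EReal.coe_sub, EReal.coe_sub]; rfl
    rw [hp', ← EReal.coe_strictMono.monotone.map_min, EReal.toReal_coe]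
    rfl

theorem dist_add_I_of_real (x y : ℝ) :
    dist (x : ℂ) ((y : ℂ) + Complex.I) = √((y - x) ^ 2 + 1) := by
  rw [Complex.dist_eq_re_im]
  congr 1
  simp
  ring

/-- Disjoint circles of equal radius have centres more than a diameter apart. -/
theorem two_mul_lt_of_disjoint_circ {d : ℕ} {ev : Fin d → ℝ} {r : ℝ} (hr : 0 ≤ r) {i j : Fin d}
    (h : Disjoint (circ ev r i) (circ ev r j)) : 2 * r < |ev i - ev j| := by
  by_contra! hle
  have hsq : 0 ≤ r ^ 2 - ((ev i - ev j) / 2) ^ 2 := by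
    have := sq_le_sq' (by linarith [abs_nonneg (ev i - ev j)]) hle
    rw [sq_abs] at this
    nlinarith
  -- Were the centres at most 2r apart, the circles would meet on the perpendicular bisector, at
  -- height q above the centres.
  set q := √(r ^ 2 - ((ev i - ev j) / 2) ^ 2) with hq
  have hq2 : q ^ 2 = r ^ 2 - ((ev i - ev j) / 2) ^ 2 := Real.sq_sqrt hsq
  have hmem : ∀ k, (ev k - (ev i + ev j) / 2) ^ 2 = ((ev i - ev j) / 2) ^ 2 →
      (⟨(ev i + ev j) / 2, 1 + q⟩ : ℂ) ∈ circ ev r k := by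
    intro k hk
    rw [circ, mem_sphere, Complex.dist_eq_re_im]
    have : ((ev i + ev j) / 2 - ev k) ^ 2 + q ^ 2 = r ^ 2 := by
      rw [hq2, ← hk]; ring
    simp [this, Real.sqrt_sq hr]
  exact Set.disjoint_left.mp h (hmem i (by ring)) (hmem j (by ring))

end Distances

/-! ### Positivity of the constant c. -/

section Constants

variable {H : Type*} [NormedAddCommGroup H] [InnerProductSpace ℂ H]
  {T : H →ₗ.[ℂ] H} {a b ε r : ℝ} {d : ℕ} {ev : Fin d → ℝ}

theorem le_dist_of_not_mem_interval {l y : ℝ} (hl : l ∈ Set.Icc a b) (hy : y < a ∨ b < y)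
    {s : ℝ} (hs : s ≤ min √((l - a) ^ 2 + 1) √((b - l) ^ 2 + 1)) :
    s ≤ dist (y : ℂ) ((l : ℂ) + Complex.I) := by
  rw [dist_add_I_of_real]
  rcases hy with hy | hy
  · refine hs.trans ((min_le_left _ _).trans (Real.sqrt_le_sqrt ?_))
    nlinarith [hl.1]
  · refine hs.trans ((min_le_right _ _).trans (Real.sqrt_le_sqrt ?_))
    nlinarith [hl.2]

theorem le_dist_center_circ (hr0 : 0 ≤ r)
    (hdisj : ∀ i j, ev i ≠ ev j → Disjoint (circ ev r i) (circ ev r j)) (k i : Fin d) {z : ℂ}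
    (hz : z ∈ circ ev r i) : r ≤ dist ((ev k : ℂ) + Complex.I) z := by
  have hz' : dist z ((ev i : ℂ) + Complex.I) = r := hz
  by_cases hki : ev k = ev i
  · rw [hki, dist_comm, hz']
  · have h1 := two_mul_lt_of_disjoint_circ hr0 (hdisj k i hki)
    have h2 := dist_triangle ((ev k : ℂ) + Complex.I) z ((ev i : ℂ) + Complex.I)
    rw [hz', dist_add_right, Complex.dist_eq, ← Complex.ofReal_sub, Complex.norm_real,
      Real.norm_eq_abs] at h2
    linarith

/-- The properties of the constant `c` which are used in the proof. -/
theorem lowerConst_spec (hε : 0 ≤ ε) (hIcc : ∀ j, ev j ∈ Set.Icc a b) (hreal : ∀ y ∈ spectrum T,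
      y ∉ realInterval a b → ∃ x : ℝ, (x : ℂ) = y ∧ (x < a ∨ b < x))
    (hr : ∀ j, 3 * ε < r ∧
      r < min √((ev j - a) ^ 2 + 1) √((b - ev j) ^ 2 + 1) - 1 - 2 * ε)
    (hdisj : ∀ i j, ev i ≠ ev j → Disjoint (circ ev r i) (circ ev r j)) (j : Fin d) :
    0 < lowerConst T a b ev r ε ∧
    (∀ k, ∀ z ∈ circUnion ev r,
      lowerConst T a b ev r ε + 3 * ε ≤ dist ((ev k : ℂ) + Complex.I) z) ∧
    (∀ z ∈ circUnion ev r, ∀ y ∈ spectrum T \ realInterval a b,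
      lowerConst T a b ev r ε + 1 + 2 * ε ≤ dist z y) := by
  have hr0 : 0 < r := by linarith [(hr j).1]
  have hjX : ((ev j : ℂ) + Complex.I + r) ∈ circUnion ev r := by
    refine Set.mem_iUnion.mpr ⟨j, ?_⟩
    rw [circ, mem_sphere, dist_eq_norm, add_sub_cancel_left, Complex.norm_real,
      Real.norm_of_nonneg hr0.le]
  have hI : ∀ k, ∀ z ∈ circUnion ev r, distInner ev r ≠ ⊤ ∧
      (distInner ev r).toReal ≤ dist ((ev k : ℂ) + Complex.I) z :=
    fun k z hz => setDist_le ⟨k, rfl⟩ hz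
  have hItop := (hI j _ hjX).1
  have hIr : r ≤ (distInner ev r).toReal := by
    refine le_toReal_setDist ?_ hItop
    rintro _ ⟨k, rfl⟩ z hz
    obtain ⟨i, hi⟩ := Set.mem_iUnion.mp hz
    exact le_dist_center_circ hr0.le hdisj k i hi
  have : Nonempty (Fin d) := ⟨j⟩
  -- d_X is taken over all circles, so it is controlled by the centre λ_i + i closest to the
  -- endpoints of [a,b].
  obtain ⟨i₀, hi₀⟩ := Finite.exists_min
    fun i => min √((ev i - a) ^ 2 + 1) √((b - ev i) ^ 2 + 1)
  set s := min √((ev i₀ - a) ^ 2 + 1) √((b - ev i₀) ^ 2 + 1) with hs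
  have hsr := (hr i₀).2
  have hO : ∀ z ∈ circUnion ev r, ∀ y ∈ spectrum T \ realInterval a b, s - r ≤ dist z y := by
    intro z hz y hy
    obtain ⟨i, hi⟩ := Set.mem_iUnion.mp hz
    have hi' : dist z ((ev i : ℂ) + Complex.I) = r := hi
    obtain ⟨x, rfl, hx⟩ := hreal y hy.1 hy.2
    have h1 := le_dist_of_not_mem_interval (hIcc i) hx (hi₀ i)
    have h2 := dist_triangle_left (x : ℂ) ((ev i : ℂ) + Complex.I) z
    linarith
  rcases toReal_min_sub (p := distOuter T a b ev r) hItop ε with ⟨htop, heq⟩ | ⟨htop, heq⟩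
  · rw [lowerConst, heq]
    refine ⟨by linarith [(hr j).1], fun k z hz => by linarith [(hI k z hz).2], ?_⟩
    intro z hz y hy
    exact absurd htop (setDist_le hz hy).1
  · rw [lowerConst, heq]
    have h1 : s - r ≤ (distOuter T a b ev r).toReal := le_toReal_setDist hO htop
    refine ⟨lt_min (by linarith) (by linarith [(hr j).1]), fun k z hz => ?_, fun z hz y hy => ?_⟩
    · linarith [(hI k z hz).2, min_le_right ((distOuter T a b ev r).toReal - 1 - 2 * ε)
        ((distInner ev r).toReal - 3 * ε)]
    · have h2 : (distOuter T a b ev r).toReal ≤ dist z y := (setDist_le hz hy).2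
      linarith [min_le_left ((distOuter T a b ev r).toReal - 1 - 2 * ε)
        ((distInner ev r).toReal - 3 * ε)]

end Constants

/-! ### Reading the spectrum through y = a + x⁻¹. -/

section Main

variable {H : Type*} [NormedAddCommGroup H] [InnerProductSpace ℂ H] [CompleteSpace H]
  {T : H →ₗ.[ℂ] H} {R : H →L[ℂ] H}

theorem cfc_const_zero_vadd (T : H →ₗ.[ℂ] H) (R : H →L[ℂ] H) :
    ((cfc (fun _ : ℂ => (0 : ℂ)) R : H →L[ℂ] H) : H →ₗ[ℂ] H) +ᵥ T = T := by
  rw [cfc_const_zero, ContinuousLinearMap.toLinearMap_zero, zero_vadd]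

/-- The spectrum of a self-adjoint operator with a real point in the resolvent set is real. -/
theorem IsResolventAt.exists_real_of_mem_spectrum {a : ℝ} (h : IsResolventAt T (a : ℂ) R)
    (hR : IsSelfAdjoint R) {y : ℂ} (hy : y ∈ spectrum T) : ∃ x : ℝ, (x : ℂ) = y := by
  by_contra! hne
  have hw : ∀ x ∈ _root_.spectrum ℂ R, 1 + ((0 : ℂ) + a - y) * x ≠ 0 := by
    intro x hx h0
    have hxr : (x.re : ℂ) = x := (hR.mem_spectrum_eq_re hx).symm
    have hx0 : x ≠ 0 := by rintro rfl; simp at h0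
    refine hne (a + x.re⁻¹) ?_
    push_cast
    rw [hxr]
    field_simp
    linear_combination h0
  have hmem := (h.cfc_vadd (e := fun _ => 0) hR continuousOn_const hw).mem
  rw [cfc_const_zero_vadd] at hmem
  exact hy hmem

theorem discFun_eq_one {e : ℂ → ℂ} {a c x : ℂ} {ρ : ℝ} (hx : x ≠ 0)
    (h : dist (a + x⁻¹ + e x) c < ρ) : discFun e a c ρ x = 1 := by
  refine if_pos ?_
  have : 1 + (e x + a - c) * x = (a + x⁻¹ + e x - c) * x := by field_simp; ring
  rw [this, norm_mul, ← dist_eq_norm]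
  exact mul_lt_mul_of_pos_right h (norm_pos_iff.mpr hx)

theorem discFun_eq_zero {e : ℂ → ℂ} {a c x : ℂ} {ρ : ℝ}
    (h : x ≠ 0 → ρ < dist (a + x⁻¹ + e x) c) : discFun e a c ρ x = 0 := by
  refine if_neg ?_
  by_cases hx : x = 0
  · simp [hx]
  have : 1 + (e x + a - c) * x = (a + x⁻¹ + e x - c) * x := by field_simp; ring
  rw [this, norm_mul, ← dist_eq_norm, not_lt]
  exact mul_le_mul_of_nonneg_right (h hx).le (norm_nonneg _)

theorem norm_ne_of_dist_ne {e : ℂ → ℂ} {a c x : ℂ} {ρ : ℝ}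
    (h : x ≠ 0 → dist (a + x⁻¹ + e x) c ≠ ρ) : ‖1 + (e x + a - c) * x‖ ≠ ρ * ‖x‖ := by
  by_cases hx : x = 0
  · simp [hx]
  have : 1 + (e x + a - c) * x = (a + x⁻¹ + e x - c) * x := by field_simp; ring
  rw [this, norm_mul, ← dist_eq_norm]
  exact fun h0 => h hx (mul_right_cancel₀ (norm_ne_zero_iff.mpr hx) h0)

theorem norm_resolventFun_le {e : ℂ → ℂ} {a z x : ℂ} {δ : ℝ} (hδ : 0 < δ)
    (h : x ≠ 0 → δ ≤ dist (a + x⁻¹ + e x) z) : ‖resolventFun e a z x‖ ≤ δ⁻¹ := by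
  by_cases hx : x = 0
  · simp [hx, resolventFun, hδ.le]
  have h1 : 1 + (e x + a - z) * x = (a + x⁻¹ + e x - z) * x := by field_simp; ring
  have h2 : resolventFun e a z x = (a + x⁻¹ + e x - z)⁻¹ := by
    rw [resolventFun, h1, mul_inv]; field_simp
  rw [h2, norm_inv, ← dist_eq_norm]
  exact inv_anti₀ hδ (h hx)

end Main

end SpectralPert

end

/-! ### The spectral projection E = E([a,b]) and the model operator T + iE. -/

noncomputable section

namespace SpectralPert

open Filter Topology Metric

variable {H : Type*} [NormedAddCommGroup H] [InnerProductSpace ℂ H] [CompleteSpace H]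
  {T : H →ₗ.[ℂ] H} {R : H →L[ℂ] H}

/-- The indicator function of `(a, b)` in the spectrum of `T`, as a function of `(T - a)⁻¹`. -/
def intervalFun (a b : ℝ) : ℂ → ℂ :=
  discFun (fun _ => 0) a (((a + b) / 2 : ℝ) : ℂ) ((b - a) / 2)

theorem IsResolventAt.cases_of_mem_spectrum {a b : ℝ} (hab : a < b)
    (h : IsResolventAt T (a : ℂ) R) (hR : IsSelfAdjoint R) (hb : (b : ℂ) ∈ resolventSet T) {x : ℂ}
    (hx : x ∈ _root_.spectrum ℂ R) (hx0 : x ≠ 0) :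
    ∃ y : ℝ, (y : ℂ) = a + x⁻¹ ∧ (y : ℂ) ∈ spectrum T ∧
      ((a < y ∧ y < b ∧ dist (y : ℂ) (((a + b) / 2 : ℝ) : ℂ) < (b - a) / 2) ∨
        ((y < a ∨ b < y) ∧ (b - a) / 2 < dist (y : ℂ) (((a + b) / 2 : ℝ) : ℂ))) := by
  have hs := h.add_inv_mem_spectrum hx hx0
  obtain ⟨y, hy⟩ := h.exists_real_of_mem_spectrum hR hs
  rw [← hy] at hs
  refine ⟨y, hy, hs, ?_⟩
  have hya : y ≠ a := by rintro rfl; exact hs h.mem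
  have hyb : y ≠ b := by rintro rfl; exact hs hb
  rw [Complex.dist_eq, ← Complex.ofReal_sub, Complex.norm_real, Real.norm_eq_abs]
  rcases lt_or_gt_of_ne hya with h1 | h1
  · right
    refine ⟨Or.inl h1, ?_⟩
    rw [lt_abs]; right; linarith
  · rcases lt_or_gt_of_ne hyb with h2 | h2
    · left
      refine ⟨h1, h2, ?_⟩
      rw [abs_lt]; constructor <;> linarith
    · right
      refine ⟨Or.inr h2, ?_⟩
      rw [lt_abs]; left; linarith

theorem IsResolventAt.intervalFun_cases {a b : ℝ} (hab : a < b)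
    (h : IsResolventAt T (a : ℂ) R) (hR : IsSelfAdjoint R) (hb : (b : ℂ) ∈ resolventSet T) {x : ℂ}
    (hx : x ∈ _root_.spectrum ℂ R) (hx0 : x ≠ 0) :
    (intervalFun a b x = 1 ∧ a + x⁻¹ ∈ realInterval a b ∩ spectrum T) ∨
    (intervalFun a b x = 0 ∧ ∃ y : ℝ, (y : ℂ) = a + x⁻¹ ∧ (y < a ∨ b < y) ∧
      a + x⁻¹ ∈ spectrum T \ realInterval a b) := by
  obtain ⟨y, hy, hys, ⟨h1, h2, h3⟩ | ⟨h1, h3⟩⟩ := h.cases_of_mem_spectrum hab hR hb hx hx0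
  · left
    rw [← hy]
    refine ⟨discFun_eq_one hx0 ?_, ⟨y, ⟨h1.le, h2.le⟩, rfl⟩, hys⟩
    rwa [← hy, add_zero]
  · right
    rw [← hy]
    refine ⟨discFun_eq_zero fun _ => ?_, y, rfl, h1, hys, ?_⟩
    · rwa [← hy, add_zero]
    · rintro ⟨y', ⟨h4, h5⟩, h6⟩
      have : y' = y := Complex.ofReal_injective h6
      rcases h1 with h1 | h1 <;> linarith

theorem IsResolventAt.norm_ne_interval {a b : ℝ} (hab : a < b)
    (h : IsResolventAt T (a : ℂ) R) (hR : IsSelfAdjoint R) (hb : (b : ℂ) ∈ resolventSet T) :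
    ∀ x ∈ _root_.spectrum ℂ R,
      ‖1 + ((0 : ℂ) + a - (((a + b) / 2 : ℝ) : ℂ)) * x‖ ≠ ((b - a) / 2) * ‖x‖ := by
  intro x hx
  refine norm_ne_of_dist_ne (e := fun _ => 0) fun hx0 => ?_
  obtain ⟨y, hy, -, ⟨-, -, h3⟩ | ⟨-, h3⟩⟩ := h.cases_of_mem_spectrum hab hR hb hx hx0
  · rw [← hy, add_zero]; exact h3.ne
  · rw [← hy, add_zero]; exact h3.ne'

theorem IsResolventAt.continuousOn_intervalFun {a b : ℝ} (hab : a < b)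
    (h : IsResolventAt T (a : ℂ) R) (hR : IsSelfAdjoint R) (hb : (b : ℂ) ∈ resolventSet T) :
    ContinuousOn (intervalFun a b) (_root_.spectrum ℂ R) :=
  continuousOn_discFun continuousOn_const (h.norm_ne_interval hab hR hb)

theorem IsResolventAt.intervalProj_eq {a b : ℝ} (hab : a < b)
    (h : IsResolventAt T (a : ℂ) R) (hR : IsSelfAdjoint R) (hb : (b : ℂ) ∈ resolventSet T) :
    intervalProj T a b = cfc (intervalFun a b) R := by
  have h1 := h.spectralProj_cfc_vadd (e := fun _ => 0) hR continuousOn_const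
    (by linarith : 0 < (b - a) / 2) (h.norm_ne_interval hab hR hb)
  rw [cfc_const_zero_vadd] at h1
  exact h1

/-- Lower bounds for `T + iE - z` on the range and on the kernel of `E = E([a, b])`. -/
theorem IsResolventAt.le_norm_block {a b : ℝ} (hab : a < b)
    (h : IsResolventAt T (a : ℂ) R) (hR : IsSelfAdjoint R) (hb : (b : ℂ) ∈ resolventSet T)
    {z : ℂ} {d₁ d₂ : ℝ} (hd₁ : 0 < d₁) (hd₂ : 0 < d₂)
    (h₁ : ∀ y ∈ realInterval a b ∩ spectrum T, d₁ ≤ dist (y + Complex.I) z)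
    (h₂ : ∀ y ∈ spectrum T \ realInterval a b, d₂ ≤ dist y z) (u : T.domain) :
    d₁ * ‖intervalProj T a b u‖ ≤ ‖intervalProj T a b
      (Complex.I • intervalProj T a b u + T u - z • (u : H))‖ ∧
    d₂ * ‖(u : H) - intervalProj T a b u‖ ≤
      ‖(Complex.I • intervalProj T a b u + T u - z • (u : H)) - intervalProj T a b
        (Complex.I • intervalProj T a b u + T u - z • (u : H))‖ := by
  have hn : IsStarNormal R := hR.isStarNormal
  rw [h.intervalProj_eq hab hR hb]
  set f := intervalFun a b with hf
  set e : ℂ → ℂ := fun x => Complex.I * f x with he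
  have hfc : ContinuousOn f (_root_.spectrum ℂ R) := h.continuousOn_intervalFun hab hR hb
  have hec : ContinuousOn e (_root_.spectrum ℂ R) := continuousOn_const.mul hfc
  have hw : ∀ x ∈ _root_.spectrum ℂ R, 1 + (e x + a - z) * x ≠ 0 := by
    intro x hx
    by_cases hx0 : x = 0
    · simp [hx0]
    have h0 : 1 + (e x + a - z) * x = (a + x⁻¹ + e x - z) * x := by field_simp; ring
    rw [h0]
    refine mul_ne_zero ?_ hx0
    rw [← norm_pos_iff, ← dist_eq_norm]
    rcases h.intervalFun_cases hab hR hb hx hx0 with ⟨h3, h4⟩ | ⟨h3, -, -, -, h4⟩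
    · simp only [he, hf, h3, mul_one]; exact hd₁.trans_le (h₁ _ h4)
    · simp only [he, hf, h3, mul_zero, add_zero]; exact hd₂.trans_le (h₂ _ h4)
  have hN := h.cfc_vadd hR hec hw
  have hNc := continuousOn_resolventFun hec hw
  have hE : IsStarProjection (cfc f R) := isStarProjection_cfc_discFun hR hfc
  have heE : cfc e R = Complex.I • cfc f R := cfc_const_mul _ _ R hfc
  have hcomm : Commute (cfc f R) (cfc (resolventFun e a z) R) := cfc_commute_cfc _ _ R
  have hNu := hN.2 u
  rw [LinearPMap.vadd_apply, ContinuousLinearMap.coe_coe, heE, smul_apply] at hNu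
  set E : H →L[ℂ] H := cfc f R with hEdef
  set N : H →L[ℂ] H := cfc (resolventFun e a z) R with hNdef
  set v := Complex.I • E u + T u - z • (u : H) with hv
  clear_value v
  -- N is the resolvent of T + iE at z and Nv = u. As N commutes with E, each block of u is N
  -- applied to that block of v, and the bounds on NE and N(1 - E) are suprema of scalar functions
  -- over the two parts of the spectrum.
  have hEN : ∀ w, E (N w) = N (E w) := fun w => congrArg (fun g : H →L[ℂ] H => g w) hcomm.eq
  have hNE : ‖N * E‖ ≤ d₁⁻¹ := by
    rw [hNdef, hEdef, ← cfc_mul _ _ R hNc hfc]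
    refine norm_cfc_le (by positivity) fun x hx => ?_
    by_cases hx0 : x = 0
    · simp [hx0, resolventFun, hd₁.le]
    rcases h.intervalFun_cases hab hR hb hx hx0 with ⟨h3, h4⟩ | ⟨h3, -, -, -, h4⟩
    · rw [hf, h3, mul_one]
      refine norm_resolventFun_le hd₁ fun _ => ?_
      simp only [he, hf, h3, mul_one]; exact h₁ _ h4
    · rw [hf, h3]; simp [hd₁.le]
  have hNE' : ‖N * (1 - E)‖ ≤ d₂⁻¹ := by
    have h1E : 1 - E = cfc (fun x => 1 - f x) R := by
      rw [cfc_sub (fun _ => 1) f R continuousOn_const hfc, cfc_const_one ℂ R]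
    rw [h1E, hNdef, ← cfc_mul _ (fun x => 1 - f x) R hNc (continuousOn_const.sub hfc)]
    refine norm_cfc_le (by positivity) fun x hx => ?_
    by_cases hx0 : x = 0
    · simp [hx0, resolventFun, hd₂.le]
    rcases h.intervalFun_cases hab hR hb hx hx0 with ⟨h3, h4⟩ | ⟨h3, -, -, -, h4⟩
    · rw [hf, h3]; simp [hd₂.le]
    · rw [hf, h3, sub_zero, mul_one]
      refine norm_resolventFun_le hd₂ fun _ => ?_
      simp only [he, hf, h3, mul_zero, add_zero]; exact h₂ _ h4
  have hEE := apply_apply_of_isStarProjection hE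
  constructor
  · have h5 : (N * E) (E v) = E u := by
      rw [mul_apply_eq_comp, hEE, ← hEN, hNu]
    have h6 := (N * E).le_of_opNorm_le hNE (E v)
    rw [h5, inv_mul_eq_div, le_div_iff₀ hd₁] at h6
    linarith
  · have h5 : (N * (1 - E)) (v - E v) = u - E u := by
      rw [mul_apply_eq_comp, sub_apply, one_apply_eq_self, map_sub E v (E v), hEE, sub_self, sub_zero,
        map_sub, ← hEN, hNu]
    have h6 := (N * (1 - E)).le_of_opNorm_le hNE' (v - E v)
    rw [h5, inv_mul_eq_div, le_div_iff₀ hd₂] at h6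
    linarith

/-- The Riesz projection of `T + iE`, `E = E([a, b])`, around `l + i`. -/
theorem IsResolventAt.spectralSubspace_add_I_smul {a b : ℝ} (hab : a < b)
    (h : IsResolventAt T (a : ℂ) R) (hR : IsSelfAdjoint R) (hb : (b : ℂ) ∈ resolventSet T)
    {l r : ℝ} (hr : 0 < r) (hl : (l : ℂ) ∈ realInterval a b ∩ spectrum T)
    (h₁ : ∀ y ∈ realInterval a b ∩ spectrum T, y ≠ l → r < dist y l)
    (h₂ : ∀ y : ℝ, y < a ∨ b < y → r < dist (y : ℂ) (l + Complex.I)) :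
    sphere ((l : ℂ) + Complex.I) r ⊆ resolventSet
      (((Complex.I • intervalProj T a b : H →L[ℂ] H) : H →ₗ[ℂ] H) +ᵥ T) ∧
    spectralSubspace (((Complex.I • intervalProj T a b : H →L[ℂ] H) : H →ₗ[ℂ] H) +ᵥ T)
      (l + Complex.I) r = eigenspace T l := by
  have hn : IsStarNormal R := hR.isStarNormal
  rw [h.intervalProj_eq hab hR hb]
  set f := intervalFun a b with hf
  set e : ℂ → ℂ := fun x => Complex.I * f x with he
  have hfc : ContinuousOn f (_root_.spectrum ℂ R) := h.continuousOn_intervalFun hab hR hb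
  have hec : ContinuousOn e (_root_.spectrum ℂ R) := continuousOn_const.mul hfc
  have heE : cfc e R = Complex.I • cfc f R := cfc_const_mul _ _ R hfc
  have hla : (l : ℂ) - a ≠ 0 := by
    intro h0
    rw [sub_eq_zero] at h0
    rw [h0] at hl
    exact hl.2 h.mem
  set x₀ : ℂ := ((l : ℂ) - a)⁻¹ with hx₀
  have hx₀' : (a : ℂ) + x₀⁻¹ = l := by rw [hx₀, inv_inv]; ring
  -- In the functional calculus T + iE takes the values y + i for y in [a,b] and y outside. Only x₀,
  -- that is y = l, gives a point in the disc about l + i.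
  have hfar : ∀ x ∈ _root_.spectrum ℂ R, x ≠ x₀ → x ≠ 0 →
      r < dist (a + x⁻¹ + e x) (l + Complex.I) := by
    intro x hx hxx hx0
    rcases h.intervalFun_cases hab hR hb hx hx0 with ⟨h3, h4⟩ | ⟨h3, y, hy, h5, -⟩
    · simp only [he, hf, h3, mul_one, dist_add_right]
      refine h₁ _ h4 fun h0 => hxx ?_
      rw [hx₀, ← h0, add_sub_cancel_left, inv_inv]
    · simp only [he, hf, h3, mul_zero, add_zero, ← hy]
      exact h₂ y h5
  have hnear : ∀ x ∈ _root_.spectrum ℂ R, x = x₀ → a + x⁻¹ + e x = l + Complex.I := by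
    rintro x hx rfl
    rcases h.intervalFun_cases hab hR hb hx (inv_ne_zero hla) with ⟨h3, h4⟩ | ⟨h3, y, hy, h5, h6⟩
    · simp only [he, hf, h3, mul_one, hx₀']
    · rw [hx₀'] at h6
      exact absurd hl.1 h6.2
  have hne : ∀ x ∈ _root_.spectrum ℂ R,
      ‖1 + (e x + a - (l + Complex.I)) * x‖ ≠ r * ‖x‖ := by
    intro x hx
    refine norm_ne_of_dist_ne fun hx0 => ?_
    by_cases hxx : x = x₀
    · rw [hnear x hx hxx, dist_self]; exact hr.ne
    · exact (hfar x hx hxx hx0).ne'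
  rw [← heE]
  refine ⟨fun z hz => (h.cfc_vadd hR hec fun x hx =>
    one_add_mul_ne_zero_of_mem_sphere (hne x hx) hz).mem, ?_⟩
  rw [spectralSubspace, h.spectralProj_cfc_vadd hR hec hr hne, ← hx₀']
  refine range_cfc_eq_eigenspace h hR (continuousOn_discFun hec ?_) (inv_ne_zero hla) ?_ ?_
  · rw [hx₀']; exact hne
  · intro x hx hxx
    refine discFun_eq_one (by rw [hxx]; exact inv_ne_zero hla) ?_
    rw [hnear x hx hxx, hx₀', dist_self]; exact hr
  · intro x hx hxx
    refine discFun_eq_zero fun hx0 => ?_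
    rw [hx₀']; exact hfar x hx hxx hx0

end SpectralPert

end

/-! ### Spectrum inside the circle and the final assembly. -/

noncomputable section

namespace SpectralPert

open Filter Topology Metric

variable {H : Type*} [NormedAddCommGroup H] [InnerProductSpace ℂ H] [CompleteSpace H]

/-- If the Riesz projection does not vanish, the disc contains a point of the spectrum. -/
theorem infEDist_spectrum_lt {A : H →ₗ.[ℂ] H} {c : ℂ} {r : ℝ} (hr : 0 < r)
    (hs : sphere c r ⊆ resolventSet A) (h : spectralSubspace A c r ≠ ⊥) :
    infEDist c (spectrum A) < ENNReal.ofReal r := by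
  by_contra! hle
  refine h ?_
  have hsub : closedBall c r ⊆ resolventSet A := by
    intro z hz
    rcases (mem_closedBall.mp hz).lt_or_eq with hlt | heq
    · by_contra hz'
      have h1 : ENNReal.ofReal r ≤ edist c z := hle.trans (infEDist_le_edist_of_mem hz')
      rw [edist_dist, dist_comm, ENNReal.ofReal_le_ofReal_iff dist_nonneg] at h1
      linarith
    · exact hs heq
  rw [spectralSubspace, spectralProj_eq_zero hr.le hsub]
  simp

end SpectralPert

end

theorem theorem3p3 {H : Type*} [NormedAddCommGroup H] [InnerProductSpace ℂ H] [CompleteSpace H]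
    (T : H →ₗ.[ℂ] H) (hT : IsSelfAdjoint T)
    (a b : ℝ) (hab : a < b)
    (ha : (a : ℂ) ∈ SpectralPert.resolventSet T) (hb : (b : ℂ) ∈ SpectralPert.resolventSet T)
    -- the spectrum of `T` in `[a, b]` is discrete and listed by `ev`, repeated by multiplicity
    (d : ℕ) (ev : Fin d → ℝ)
    (hev : SpectralPert.realInterval a b ∩ SpectralPert.spectrum T =
      Set.range fun j => (ev j : ℂ))
    (hdis : ∀ j, (ev j : ℂ) ∈ SpectralPert.discreteSpectrum T)
    (hmult : ∀ j, Nat.card {k : Fin d // ev k = ev j} =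
      Module.finrank ℂ (SpectralPert.eigenspace T (ev j : ℂ)))
    -- the finite rank orthogonal projection
    (Q : H →L[ℂ] H) (hQ : IsStarProjection Q)
    (hQfin : FiniteDimensional ℂ (LinearMap.range (Q : H →ₗ[ℂ] H)))
    (ε : ℝ) (hε : ‖(1 - Q) * SpectralPert.intervalProj T a b‖ = ε) (hεd : ε < 1 / √(d : ℝ))
    -- the radius of the circles
    (r : ℝ)
    (hr : ∀ j, 3 * ε < r ∧
      r < min √((ev j - a) ^ 2 + 1) √((b - ev j) ^ 2 + 1) - 1 - 2 * ε)
    (hdisj : ∀ i j, ev i ≠ ev j →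
      Disjoint (SpectralPert.circ ev r i) (SpectralPert.circ ev r j))
    (j : Fin d) :
    SpectralPert.circ ev r j ⊆ SpectralPert.resolventSet (SpectralPert.perturb T Q) ∧
    Metric.infEDist ((ev j : ℂ) + Complex.I)
      (SpectralPert.spectrum (SpectralPert.perturb T Q)) < ENNReal.ofReal r ∧
    0 < SpectralPert.lowerConst T a b ev r ε ∧
    (∀ z ∈ SpectralPert.circ ev r j, ∀ u : T.domain,
      SpectralPert.lowerConst T a b ev r ε * ‖(u : H)‖ ≤
        ‖T u + Complex.I • Q (u : H) - z • (u : H)‖) ∧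
    FiniteDimensional ℂ
      (SpectralPert.spectralSubspace (SpectralPert.perturb T Q) ((ev j : ℂ) + Complex.I) r) ∧
    Module.finrank ℂ
      (SpectralPert.spectralSubspace (SpectralPert.perturb T Q) ((ev j : ℂ) + Complex.I) r) =
        Module.finrank ℂ (SpectralPert.eigenspace T (ev j : ℂ)) := by
  open SpectralPert Metric in
  obtain ⟨R, hRes⟩ := ha
  have hR : IsSelfAdjoint R := hRes.isSelfAdjoint hT
  have hεnn : 0 ≤ ε := hε ▸ norm_nonneg _
  have hr0 : 0 < r := by linarith [(hr j).1]
  have hmem : ∀ k, (ev k : ℂ) ∈ realInterval a b ∩ spectrum T := fun k => hev ▸ ⟨k, rfl⟩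
  have hIcc : ∀ k, ev k ∈ Set.Icc a b := by
    intro k
    obtain ⟨y, hy, h1⟩ := (hmem k).1
    rwa [Complex.ofReal_injective h1] at hy
  have hreal : ∀ y ∈ spectrum T, y ∉ realInterval a b →
      ∃ x : ℝ, (x : ℂ) = y ∧ (x < a ∨ b < x) := by
    intro y hy hy'
    obtain ⟨x, rfl⟩ := hRes.exists_real_of_mem_spectrum hR hy
    refine ⟨x, rfl, ?_⟩
    by_contra! hx
    exact hy' ⟨x, hx, rfl⟩
  obtain ⟨hc0, hcI, hcO⟩ := lowerConst_spec hεnn hIcc hreal hr hdisj j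
  set c := lowerConst T a b ev r ε
  set E := intervalProj T a b with hEdef
  have hE : IsStarProjection E := by
    rw [hEdef, hRes.intervalProj_eq hab hR hb]
    exact isStarProjection_cfc_discFun hR (hRes.continuousOn_intervalFun hab hR hb)
  obtain ⟨P, hP₁, hP₂, hP₃, hP₄⟩ := exists_subprojection hE hQ hQfin
  rw [hε] at hP₄
  -- the uniform lower bound along the segment from `T + iE` to `T + iQ`
  have hbound : ∀ t ∈ Set.Icc (0 : ℝ) 1, ∀ z ∈ circ ev r j, ∀ u : T.domain,
      c * ‖(u : H)‖ ≤ ‖(Complex.I • E : H →L[ℂ] H) u +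
        (t : ℂ) • (Complex.I • (Q - E) : H →L[ℂ] H) u + T u - z • (u : H)‖ := by
    intro t ht z hz u
    have hzX : z ∈ circUnion ev r := Set.mem_iUnion.mpr ⟨j, hz⟩
    -- By definition of c, d_Δ ≥ c + 3ε, and d_X ≥ c + 1 + 2ε when there is spectrum outside [a,b].
    -- These exceed the c + ε and c + 1 + ε that the perturbation estimate requires.
    obtain ⟨hu₁, hu₂⟩ := hRes.le_norm_block hab hR hb (z := z) (d₁ := c + 3 * ε)
      (d₂ := c + 1 + 2 * ε) (by linarith) (by linarith)
      (fun y hy => by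
        rw [hev] at hy
        obtain ⟨k, rfl⟩ := hy
        exact hcI k z hzX)
      (fun y hy => by rw [dist_comm]; exact hcO z hzX y hy) u
    have hs : ‖(t : ℂ) * Complex.I‖ ≤ 1 := by
      rw [norm_mul, Complex.norm_I, mul_one, Complex.norm_real, Real.norm_of_nonneg ht.1]
      exact ht.2
    refine (norm_add_smul_ge hE hP₁ hP₂ hP₃ hP₄ hc0.le (by linarith) (by linarith) hu₁ hu₂
      hs).trans_eq ?_
    congr 1
    simp only [smul_apply, sub_apply]
    module
  obtain ⟨hs₀, hsub₀⟩ := hRes.spectralSubspace_add_I_smul hab hR hb hr0 (hmem j)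
    (fun y hy hne => by
      rw [hev] at hy
      obtain ⟨k, rfl⟩ := hy
      have hkj : ev k ≠ ev j := fun h0 => hne (by simp only [h0])
      have := two_mul_lt_of_disjoint_circ hr0.le (hdisj k j hkj)
      rw [Complex.dist_eq, ← Complex.ofReal_sub, Complex.norm_real, Real.norm_eq_abs]
      linarith)
    (fun y hy => by
      have := le_dist_of_not_mem_interval (hIcc j) hy le_rfl
      linarith [(hr j).2])
  obtain ⟨-, -, heig, hfin⟩ := hdis j
  obtain ⟨h1, h2, h3⟩ := spectralProj_homotopy (Complex.I • E) (Complex.I • (Q - E)) hr0 hc0 hs₀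
    hbound (hsub₀ ▸ hfin)
  rw [hsub₀] at h3
  -- The endpoint of the segment is iE + i(Q - E) = iQ.
  rw [← smul_add, add_sub_cancel, ← perturb_eq] at h1 h2 h3
  -- The distance to an empty set is `⊤`, so the strict bound contains the nonemptiness of the
  -- spectrum. The lower bound of part 2 is the case t = 1.
  refine ⟨h1, infEDist_spectrum_lt hr0 h1 ?_, hc0, ?_, h2, h3⟩
  · intro h0
    rw [h0, finrank_bot] at h3
    exact heig (Submodule.finrank_eq_zero.mp h3.symm)
  · intro z hz u
    refine (hbound 1 ⟨zero_le_one, le_rfl⟩ z hz u).trans_eq ?_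
    congr 1
    simp only [smul_apply, sub_apply, Complex.ofReal_one]
    module
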